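/- **Theorem (substitution law for aromatic series).** *Graphs.* An aromatic forest is an isomorphism class of finite directed graphs (loops and the empty graph allowed, edge set $E\subseteq V\times V$) in which each node has at most one outgoing edge; a root is a node without outgoing edge; an aromatic tree is an aromatic forest with exactly one root. Let $\mathcal{AF}$ and $\mathcal{AT}$ be the sets of aromatic forests and aromatic trees, $|\phi|$ the number of nodes and $\sigma(\phi)$ the order of the automorphism group of $\phi$. A partition $p$ of $\phi=(V,E)$ is a partition of $V$ into non-empty blocks together with a choice, on each block $W$, of a subgraph $(W,E_W)$, $E_W\subseteq E\cap(W\times W)$ (not necessarily the full subgraph), which is an aromatic tree; equivalently, edges are cut and the resulting components grouped so that each group has exactly one root. $P(p)$ is the multiset of these aromatic trees. The skeleton $\chi(p)\in\mathcal{AF}$ has the blocks as nodes, and each edge $(u,v)\in E$ which is in no $E_W$ becomes an edge from the block of $u$ to the block of $v$ (a loop if the two coincide). $\mathcal P(\phi)$ is the (finite) set of partitions of $\phi$. *Series.* Let $\Bbbk$ be $\mathbb{R}$ or $\mathbb{C}$. Smooth functions are the $\Bbbk$-valued smooth functions on $\mathbb{R}^d$ or, if $\Bbbk=\mathbb{C}$,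 also the holomorphic functions on $\mathbb{C}^d$. Let $h$ be a formal variable. A formal function is a formal power series in $h$ whose coefficients are smooth functions; a formal vector field $f=(f^1,\dots,f^d)$ is a $d$-tuple of formal functions; partial derivatives act on the coefficients. For an aromatic forest $\phi=(V,E)$ and a formal function $G$ put $$F_f(\phi)[G]=\sum_{i:V\to\{1,\dots,d\}}\ \prod_{p\in V}\Big(\prod_{q:(q,p)\in E}\partial_{i_q}\Big)f^{i_p}\cdot\Big(\prod_{s\text{ root}}\partial_{i_s}\Big)G .$$ For $\tau\in\mathcal{AT}$ this is a first order operator, that is, a formal vector field $F_f(\tau)$ with components $F_f(\tau)[x_j]$. For $b:\mathcal{AT}\to\Bbbk$ and $a:\mathcal{AF}\to\Bbbk$ put $$B_f(b)=\sum_{\tau\in\mathcal{AT}}\frac{b(\tau)}{\sigma(\tau)}F_f(\tau),\qquad S_f(a)[G]=\sum_{\phi\in\mathcal{AF}}\frac{a(\phi)}{\sigma(\phi)}F_f(\phi)[G],$$ $$B^h_f(b)=\sum_{\tau\in\mathcal{AT}}h^{|\tau|}\frac{b(\tau)}{\sigma(\tau)}F_f(\tau),\qquad S^h_f(a)[G]=\sum_{\phi\in\mathcal{AF}}h^{|\phi|}\frac{a(\phi)}{\sigma(\phi)}F_f(\phi)[G],$$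 whenever each power of $h$ receives a non-zero contribution from only finitely many terms (the series is then said to be well defined). Finally let $$(b\star a)(\phi)=\sum_{p\in\mathcal P(\phi)}a(\chi(p))\prod_{\theta\in P(p)}b(\theta).$$ *Claim.* Let $f$ be a formal vector field, $b:\mathcal{AT}\to\Bbbk$ and $a:\mathcal{AF}\to\Bbbk$. 1. If $f$ has zero constant term in $h$ (the step size is contained in $f$), then $B_f(b)$ and, for every formal function $G$, $S_{B_f(b)}(a)[G]$ and $S_f(b\star a)[G]$ are well defined, and $S_{B_f(b)}(a)[G]=S_f(b\star a)[G]$. 2. For every $f$ (in particular for $f$ an ordinary smooth vector field, independent of $h$), $B^h_f(b)$ and, for every formal function $G$, $S_{B^h_f(b)}(a)[G]$ and $S^h_f(b\star a)[G]$ are well defined, and $S_{B^h_f(b)}(a)[G]=S^h_f(b\star a)[G]$. -/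

import Mathlib

open scoped ContDiff

namespace Aromatic

noncomputable section

/-! ### Aromatic graphs, aromatic forests, aromatic trees -/

/-- A directed graph on the vertex set `V` in which each node has at most one outgoing edge:
`g v = some w` means that `(v, w)` is an edge, `g v = none` that `v` is a root. -/
abbrev AGraph (V : Type) : Type := V → Option V

/-- The bijection `e` maps the edge set of `g₁` onto the edge set of `g₂`. -/
def IsIso {V W : Type} (e : V ≃ W) (g₁ : AGraph V) (g₂ : AGraph W) : Prop :=
  ∀ v, g₂ (e v) = (g₁ v).map e

theorem IsIso.rfl' {V : Type} (g : AGraph V) : IsIso (Equiv.refl V) g g := by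
  intro v; simp

theorem IsIso.symm {V W : Type} {e : V ≃ W} {g₁ : AGraph V} {g₂ : AGraph W}
    (h : IsIso e g₁ g₂) : IsIso e.symm g₂ g₁ := by
  intro w
  have := h (e.symm w)
  rw [e.apply_symm_apply] at this
  rw [this]
  cases g₁ (e.symm w) <;> simp

theorem IsIso.comp {U V W : Type} {e : U ≃ V} {e' : V ≃ W} {g₁ : AGraph U} {g₂ : AGraph V}
    {g₃ : AGraph W} (h : IsIso e g₁ g₂) (h' : IsIso e' g₂ g₃) :
    IsIso (e.trans e') g₁ g₃ := by
  intro u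
  have h1 := h u
  have h2 := h' (e u)
  rw [Equiv.trans_apply, h2, h1]
  cases g₁ u <;> simp

/-- Equivalence of finite graphs (on the standard vertex sets `Fin n`). -/
instance graphSetoid : Setoid (Σ n : ℕ, AGraph (Fin n)) where
  r x y := ∃ e : Fin x.1 ≃ Fin y.1, IsIso e x.2 y.2
  iseqv :=
    { refl := fun _ => ⟨Equiv.refl _, IsIso.rfl' _⟩
      symm := fun ⟨e, h⟩ => ⟨e.symm, h.symm⟩
      trans := fun ⟨e, h⟩ ⟨e', h'⟩ => ⟨e.trans e', h.comp h'⟩ }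

/-- Aromatic forests: equivalence classes of finite directed graphs in which each node has at
most one outgoing edge. -/
def AF : Type := Quotient graphSetoid

/-- The class of a graph on an arbitrary finite vertex set. -/
def AGraph.toAF {V : Type} [Fintype V] (g : AGraph V) : AF :=
  Quotient.mk graphSetoid
    ⟨Fintype.card V, fun k => (g ((Fintype.equivFin V).symm k)).map (Fintype.equivFin V)⟩

/-- The number of vertices. -/
def AF.size (φ : AF) : ℕ := (Quotient.out φ).1

/-- A member of the equivalence class `φ`. -/
def AF.graph (φ : AF) : AGraph (Fin φ.size) := (Quotient.out φ).2

/-- The member chosen in the class of `g` is isomorphic to `g`. -/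
theorem AGraph.exists_iso_toAF {V : Type} [Fintype V] (g : AGraph V) :
    ∃ e : V ≃ Fin g.toAF.size, IsIso e g g.toAF.graph := by
  obtain ⟨e, he⟩ := Setoid.symm (Quotient.mk_out (s := graphSetoid)
    ⟨Fintype.card V, fun k => (g ((Fintype.equivFin V).symm k)).map (Fintype.equivFin V)⟩)
  refine ⟨(Fintype.equivFin V).trans e, IsIso.comp (g₂ := fun k =>
    (g ((Fintype.equivFin V).symm k)).map (Fintype.equivFin V)) ?_ he⟩
  intro v
  simp

/-- The roots (nodes without outgoing edge). -/
def AGraph.roots {V : Type} [Fintype V] (g : AGraph V) : Finset V :=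
  Finset.univ.filter fun v => (g v).isNone = true

/-- The direct predecessors of `p`. -/
def AGraph.pred {V : Type} [Fintype V] [DecidableEq V] (g : AGraph V) (p : V) : Finset V :=
  Finset.univ.filter fun q => g q = some p

/-- The order of the automorphism group of an aromatic forest. -/
def AF.sigma (φ : AF) : ℕ :=
  Nat.card {e : Equiv.Perm (Fin φ.size) // IsIso e φ.graph φ.graph}

/-- Aromatic trees: aromatic forests with exactly one root. -/
def AT : Type := {φ : AF // φ.graph.roots.card = 1}

/-! ### Partitions into aromatic trees, the skeleton, and the substitution product -/

/-- A partition of the graph `g` into subgraphs with exactly one root each. The subgraphs need not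
be full subgraphs: `blocks` is the partition of the vertex set, and `kept` is the union of the
subgraphs, so the edges of `g` that are not in `kept` are the ones that have been cut. -/
@[ext]
structure GPartition {V : Type} [Fintype V] [DecidableEq V] (g : AGraph V) where
  blocks : Finpartition (Finset.univ : Finset V)
  kept : AGraph V
  kept_sub : ∀ v, kept v = none ∨ kept v = g v
  kept_mem : ∀ v w, kept v = some w → blocks.part w = blocks.part v
  one_root : ∀ W ∈ blocks.parts, ∃! v, v ∈ W ∧ kept v = none

namespace GPartition

variable {V : Type} [Fintype V] [DecidableEq V] {g : AGraph V}

instance : Fintype (GPartition g) :=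
  @Fintype.ofFinite _ (Finite.of_injective
    (fun p : GPartition g => (p.blocks, p.kept)) (by
      intro p q h
      simp only [Prod.mk.injEq] at h
      exact GPartition.ext h.1 h.2))

theorem kept_mem_block (p : GPartition g) {W : Finset V} (hW : W ∈ p.blocks.parts) {v w : V}
    (hv : v ∈ W) (h : p.kept v = some w) : w ∈ W := by
  have h1 : p.blocks.part v = W := p.blocks.part_eq_of_mem hW hv
  rw [← h1, ← p.kept_mem v w h]
  exact p.blocks.mem_part (Finset.mem_univ w)

/-- The subgraph of the partition on the block `W`. -/
def subgraph (p : GPartition g) (W : {W // W ∈ p.blocks.parts}) : AGraph {v // v ∈ W.1} :=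
  fun v => Option.pmap (fun w hw => ⟨w, hw⟩) (p.kept v.1)
    (fun _ h => p.kept_mem_block W.2 v.2 h)

/-- The root of the subgraph on the block `W`. -/
def root (p : GPartition g) (W : {W // W ∈ p.blocks.parts}) : V := (p.one_root W.1 W.2).choose

/-- The skeleton: every subgraph is collapsed to a single node. Only an edge going out of the root
of its subgraph can have been cut; it becomes an edge between the collapsed nodes (a loop, if it
stays in its block). -/
def skeleton (p : GPartition g) : AGraph {W // W ∈ p.blocks.parts} :=
  fun W => (g (p.root W)).map fun w =>
    ⟨p.blocks.part w, p.blocks.part_mem.2 (Finset.mem_univ w)⟩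

theorem subgraph_one_root (p : GPartition g) (W : {W // W ∈ p.blocks.parts}) :
    (p.subgraph W).toAF.graph.roots.card = 1 := by
  obtain ⟨e, he⟩ := (p.subgraph W).exists_iso_toAF
  obtain ⟨r, ⟨hrW, hr⟩, hu⟩ := p.one_root W.1 W.2
  rw [Finset.card_eq_one]
  refine ⟨e ⟨r, hrW⟩, ?_⟩
  ext k
  obtain ⟨v, rfl⟩ := e.surjective k
  have h0 : (p.subgraph W).toAF.graph (e v) = none ↔ p.kept v.1 = none := by
    rw [he v, Option.map_eq_none_iff, subgraph, Option.pmap_eq_none_iff]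
  simp only [AGraph.roots, Finset.mem_filter, Finset.mem_univ, true_and,
    Option.isNone_iff_eq_none, Finset.mem_singleton, e.apply_eq_iff_eq, h0]
  constructor
  · intro h; exact Subtype.ext (hu v.1 ⟨v.2, h⟩)
  · rintro rfl; exact hr

/-- The aromatic tree given by the subgraph on the block `W`. -/
def tree (p : GPartition g) (W : {W // W ∈ p.blocks.parts}) : AT :=
  ⟨(p.subgraph W).toAF, p.subgraph_one_root W⟩

end GPartition

/-- The substitution product `b ⋆ a`: the sum, over the partitions of `φ` into aromatic trees, of
the value of `a` on the skeleton times the product of the values of `b` on the trees. -/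
def subst {𝕜 : Type*} [CommRing 𝕜] (b : AT → 𝕜) (a : AF → 𝕜) (φ : AF) : 𝕜 :=
  ∑ p : GPartition φ.graph, a p.skeleton.toAF * ∏ W, b (p.tree W)

/-! ### Smooth functions, formal power series in `h`, elementary differential operators -/

section Analysis

variable (𝕂 𝕜 : Type*) [RCLike 𝕂] [RCLike 𝕜] [NormedAlgebra 𝕂 𝕜] (d : ℕ)

/-- The algebra of `𝕜`-valued functions on `𝕂ᵈ` that are smooth over `𝕂`. -/
def Smooth : Subalgebra 𝕜 ((Fin d → 𝕂) → 𝕜) where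
  carrier := {u | ContDiff 𝕂 ∞ u}
  mul_mem' := by
    intro u v hu hv
    exact ContDiff.mul (𝕜 := 𝕂) (n := ∞) (f := u) (g := v) hu hv
  add_mem' := by
    intro u v hu hv
    exact ContDiff.add (𝕜 := 𝕂) (n := ∞) (f := u) (g := v) hu hv
  algebraMap_mem' := fun c => (contDiff_const : ContDiff 𝕂 ∞ fun _ : Fin d → 𝕂 => c)

/-- Formal power series in the step size `h` whose coefficients are smooth functions. -/
abbrev Formal : Type _ := PowerSeries (Smooth 𝕂 𝕜 d)

variable {𝕂 𝕜 d}

/-- The partial derivative `∂/∂xᵢ` of a smooth function. -/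
def pd (i : Fin d) (u : Smooth 𝕂 𝕜 d) : Smooth 𝕂 𝕜 d :=
  ⟨fun x => fderiv 𝕂 u.1 x (Pi.single i 1), by
    have hu : ContDiff 𝕂 ∞ u.1 := u.2
    exact (hu.fderiv_right (m := ∞) (by simp)).clm_apply contDiff_const⟩

theorem pd_comm (i j : Fin d) (u : Smooth 𝕂 𝕜 d) : pd i (pd j u) = pd j (pd i u) := by
  have hu : ContDiff 𝕂 ∞ u.1 := u.2
  have hd : Differentiable 𝕂 (fderiv 𝕂 u.1) :=
    (hu.fderiv_right (m := ∞) (by simp)).differentiable (by simp)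
  have key : ∀ (k l : Fin d) (x : Fin d → 𝕂), (pd k (pd l u)).1 x
      = fderiv 𝕂 (fderiv 𝕂 u.1) x (Pi.single k 1) (Pi.single l 1) := by
    intro k l x
    have h1 : HasFDerivAt (fun y => fderiv 𝕂 u.1 y (Pi.single l 1))
        ((fderiv 𝕂 (fderiv 𝕂 u.1) x).flip (Pi.single l 1)) x := by
      simpa using (hd x).hasFDerivAt.clm_apply (hasFDerivAt_const (Pi.single l (1 : 𝕂)) x)
    change fderiv 𝕂 (fun y => fderiv 𝕂 u.1 y (Pi.single l 1)) x (Pi.single k 1) = _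
    rw [h1.fderiv]
    rfl
  have hs : ∀ x, IsSymmSndFDerivAt 𝕂 u.1 x := fun x =>
    hu.contDiffAt.isSymmSndFDerivAt (by
      rw [minSmoothness_of_isRCLikeNormedField]
      exact WithTop.coe_le_coe.2 (le_top : (2 : ℕ∞) ≤ ⊤))
  apply Subtype.ext
  funext x
  rw [key, key]
  exact (hs x) _ _

/-- The coordinate function `xⱼ`. -/
def coord (j : Fin d) : Smooth 𝕂 𝕜 d :=
  ⟨fun x => algebraMap 𝕂 𝕜 (x j),
    ContDiff.comp (n := ∞) (algebraMapCLM 𝕂 𝕜).contDiff (contDiff_apply 𝕂 𝕂 j)⟩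

/-- The partial derivative of a formal power series, coefficient by coefficient. -/
def fpd (i : Fin d) (u : Formal 𝕂 𝕜 d) : Formal 𝕂 𝕜 d :=
  PowerSeries.mk fun n => pd i (PowerSeries.coeff n u)

instance fpd_leftCommutative : LeftCommutative (fpd (𝕂 := 𝕂) (𝕜 := 𝕜) (d := d)) :=
  ⟨fun i j u => by ext1 n; simp [fpd, pd_comm i j]⟩

/-- The iterated partial derivative `∂ᵐ u / ∂x_{i_{q₁}} ⋯ ∂x_{i_{qₘ}}` where `q₁, …, qₘ` are the
elements of `s`. -/
def iterPd {V : Type} (i : V → Fin d) (s : Finset V) (u : Formal 𝕂 𝕜 d) : Formal 𝕂 𝕜 d :=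
  (s.val.map i).foldr fpd u

/-- The elementary differential operator of a graph: `elemDiff f g G` is the sum over all indices
`i : V → {1, …, d}` of `∏_{p ∈ V} f^{i_p}_{I_{π(p)}}` times `∏_{s root} ∂_{i_s}` applied to `G`. -/
def elemDiff {V : Type} [Fintype V] [DecidableEq V] (f : Fin d → Formal 𝕂 𝕜 d) (g : AGraph V)
    (G : Formal 𝕂 𝕜 d) : Formal 𝕂 𝕜 d :=
  ∑ i : V → Fin d, (∏ p, iterPd i (g.pred p) (f (i p))) * iterPd i g.roots G

/-- A family of formal power series whose sum makes sense coefficient by coefficient: each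
coefficient is nonzero for finitely many members only. -/
def FormallySummable {ι : Type} (t : ι → Formal 𝕂 𝕜 d) : Prop :=
  ∀ n, {x | PowerSeries.coeff n (t x) ≠ 0}.Finite

/-- The coefficientwise sum of a family of formal power series. -/
def formalSum {ι : Type} (t : ι → Formal 𝕂 𝕜 d) : Formal 𝕂 𝕜 d :=
  PowerSeries.mk fun n => ∑ᶠ x, PowerSeries.coeff n (t x)

/-- The term `a(φ) / σ(φ) F_f(φ)[G]` of an aromatic S-series. -/
def sTerm (f : Fin d → Formal 𝕂 𝕜 d) (a : AF → 𝕜) (G : Formal 𝕂 𝕜 d) (φ : AF) :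
    Formal 𝕂 𝕜 d :=
  (a φ / (φ.sigma : 𝕜)) • elemDiff f φ.graph G

/-- The term `b(τ) / σ(τ) F_f(τ)` of an aromatic B-series, in component `j`: the component of a
vector field is its value, as a first order differential operator, on the coordinate `xⱼ`. -/
def bTerm (f : Fin d → Formal 𝕂 𝕜 d) (b : AT → 𝕜) (j : Fin d) (τ : AT) : Formal 𝕂 𝕜 d :=
  (b τ / (τ.1.sigma : 𝕜)) • elemDiff f τ.1.graph (PowerSeries.C (coord j))

/-- The aromatic S-series `S_f(a)[G] = ∑_φ a(φ) / σ(φ) F_f(φ)[G]`. -/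
def sSeries (f : Fin d → Formal 𝕂 𝕜 d) (a : AF → 𝕜) (G : Formal 𝕂 𝕜 d) : Formal 𝕂 𝕜 d :=
  formalSum (sTerm f a G)

/-- The aromatic B-series `B_f(b) = ∑_τ b(τ) / σ(τ) F_f(τ)`, a formal vector field. -/
def bSeries (f : Fin d → Formal 𝕂 𝕜 d) (b : AT → 𝕜) : Fin d → Formal 𝕂 𝕜 d :=
  fun j => formalSum (bTerm f b j)

/-- The aromatic S-series with step size, `∑_φ h^{|φ|} a(φ) / σ(φ) F_f(φ)[G]`. -/
def sSeriesStep (f : Fin d → Formal 𝕂 𝕜 d) (a : AF → 𝕜) (G : Formal 𝕂 𝕜 d) : Formal 𝕂 𝕜 d :=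
  formalSum fun φ => PowerSeries.X ^ φ.size * sTerm f a G φ

/-- The aromatic B-series with step size, `∑_τ h^{|τ|} b(τ) / σ(τ) F_f(τ)`. -/
def bSeriesStep (f : Fin d → Formal 𝕂 𝕜 d) (b : AT → 𝕜) : Fin d → Formal 𝕂 𝕜 d :=
  fun j => formalSum fun τ : AT => PowerSeries.X ^ τ.1.size * bTerm f b j τ

end Analysis

end

end Aromatic

/-!
The substitution law is proved by passing from aromatic forests to graphs on the labelled vertex
sets `Fin n`. An aromatic forest with `n` nodes has `n! / σ` labellings
(`AF.card_labellings_mul_sigma`), so that the weights `1 / σ` turn an S-series into an exponential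
generating function: the terms with `n` nodes are `1 / n!` times a sum over all graphs on `Fin n`
(`coeff_sSeries`). A B-series is the S-series, applied to the coordinate functions, of the
coefficients extended by zero from trees to forests (`bSeries_eq_sSeries`).

Substituting the B-series into the operator of a graph `s` on `Fin m` gives a product, over the
nodes of `s`, of exponential generating functions. The product is again an exponential generating
function, whose `n`-th coefficient is a sum over the maps `Fin n → Fin m` and over graphs on their
fibres (`X_pow_dvd_prod_sum_sub`); these data are `TreeCover`s, as only trees contribute. The
derivatives coming from the edges of `s` are distributed over the nodes of the trees by the Leibniz
rule (`prod_iterPd_prod`). Each choice attaches an edge of `s` to a node of the tree at its end, and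
so yields the operator of a single graph on `Fin n` (`sum_elemDiff_sub`). Every graph together with
a partition into trees labelled by `Fin m` arises exactly once in this way, `s` being its skeleton
(`TreeCover.sum_graft`, `GPartition.exists_toCover_eq`, `GPartition.toCover_injective`). The factor
`1 / m!` of the outer series removes the labels of the blocks (`subst_toAF`), which leaves the
substitution product.

All series are compared modulo `X ^ (N + 1)`. A vector field without constant term in `h` gives one
factor `X` per node, so that only finitely many graphs matter. The version with explicit step size
is the first one for the vector field `X * f`.
-/

namespace Aromatic

noncomputable section

/-! ### Partial derivatives of formal functions -/

section PartialDerivatives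

variable {𝕂 𝕜 : Type*} [RCLike 𝕂] [RCLike 𝕜] [NormedAlgebra 𝕂 𝕜] {d : ℕ}

theorem smooth_differentiableAt (u : Smooth 𝕂 𝕜 d) (x : Fin d → 𝕂) :
    DifferentiableAt 𝕂 u.1 x :=
  (ContDiff.differentiable (n := ∞) u.2 (by simp)).differentiableAt

theorem pd_add (i : Fin d) (u v : Smooth 𝕂 𝕜 d) : pd i (u + v) = pd i u + pd i v := by
  apply Subtype.ext
  funext x
  change fderiv 𝕂 (u.1 + v.1) x _ = fderiv 𝕂 u.1 x _ + fderiv 𝕂 v.1 x _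
  rw [fderiv_add (smooth_differentiableAt u x) (smooth_differentiableAt v x)]
  rfl

theorem pd_smul (i : Fin d) (c : 𝕜) (u : Smooth 𝕂 𝕜 d) : pd i (c • u) = c • pd i u := by
  apply Subtype.ext
  funext x
  change fderiv 𝕂 (c • u.1) x _ = c • fderiv 𝕂 u.1 x _
  rw [fderiv_const_smul (smooth_differentiableAt u x)]
  rfl

theorem pd_mul (i : Fin d) (u v : Smooth 𝕂 𝕜 d) :
    pd i (u * v) = u * pd i v + v * pd i u := by
  apply Subtype.ext
  funext x
  change fderiv 𝕂 (u.1 * v.1) x _ = u.1 x * fderiv 𝕂 v.1 x _ + v.1 x * fderiv 𝕂 u.1 x _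
  rw [fderiv_mul (smooth_differentiableAt u x) (smooth_differentiableAt v x)]
  rfl

/-- The partial derivative of smooth functions as an additive map. -/
def pdHom (i : Fin d) : Smooth 𝕂 𝕜 d →+ Smooth 𝕂 𝕜 d := AddMonoidHom.mk' (pd i) (pd_add i)

theorem pd_coord (i j : Fin d) :
    pd i (coord j : Smooth 𝕂 𝕜 d) = if i = j then 1 else 0 := by
  apply Subtype.ext
  funext x
  change fderiv 𝕂 (fun y : Fin d → 𝕂 => algebraMap 𝕂 𝕜 (y j)) x (Pi.single i 1) = _
  have h : HasFDerivAt (fun y : Fin d → 𝕂 => algebraMap 𝕂 𝕜 (y j))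
      ((algebraMapCLM 𝕂 𝕜).comp (ContinuousLinearMap.proj j)) x :=
    ((algebraMapCLM 𝕂 𝕜).comp
      (ContinuousLinearMap.proj (R := 𝕂) (φ := fun _ : Fin d => 𝕂) j)).hasFDerivAt
  rw [h.fderiv]
  by_cases hij : i = j
  · subst hij
    simp
  · simp [hij]

@[simp]
theorem coeff_fpd (i : Fin d) (u : Formal 𝕂 𝕜 d) (n : ℕ) :
    PowerSeries.coeff n (fpd i u) = pd i (PowerSeries.coeff n u) := by
  simp [fpd]

theorem coeff_smul_formal (c : 𝕜) (u : Formal 𝕂 𝕜 d) (n : ℕ) :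
    PowerSeries.coeff n (c • u) = c • PowerSeries.coeff n u := rfl

/-- The partial derivative of formal functions as a linear map. -/
def fpdLin (i : Fin d) : Formal 𝕂 𝕜 d →ₗ[𝕜] Formal 𝕂 𝕜 d where
  toFun := fpd i
  map_add' u v := by ext1 n; simp [pd_add]
  map_smul' c u := by ext1 n; simp [pd_smul]

theorem fpd_mul (i : Fin d) (u v : Formal 𝕂 𝕜 d) :
    fpd i (u * v) = fpd i u * v + u * fpd i v := by
  ext1 n
  rw [coeff_fpd, PowerSeries.coeff_mul, map_add, PowerSeries.coeff_mul, PowerSeries.coeff_mul,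
    ← Finset.sum_add_distrib]
  change pdHom i (∑ _ ∈ _, _) = _
  rw [map_sum]
  refine Finset.sum_congr rfl fun x _ => ?_
  change pd i _ = _
  rw [pd_mul, coeff_fpd, coeff_fpd]
  ring

theorem fpd_one (i : Fin d) : fpd i (1 : Formal 𝕂 𝕜 d) = 0 := by
  have h := fpd_mul i (1 : Formal 𝕂 𝕜 d) 1
  simpa using h

theorem fpd_prod {P : Type*} [DecidableEq P] (i : Fin d) (s : Finset P)
    (X : P → Formal 𝕂 𝕜 d) :
    fpd i (∏ p ∈ s, X p) = ∑ r ∈ s, ∏ p ∈ s, if p = r then fpd i (X p) else X p := by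
  induction s using Finset.induction_on with
  | empty => simpa using fpd_one i
  | insert q s hq ih =>
    rw [Finset.prod_insert hq, fpd_mul, ih, Finset.sum_insert hq, Finset.prod_insert hq, if_pos rfl,
      Finset.mul_sum]
    congr 1
    · congr 1
      refine Finset.prod_congr rfl fun p hp => ?_
      rw [if_neg (ne_of_mem_of_not_mem hp hq)]
    · refine Finset.sum_congr rfl fun r hr => ?_
      rw [Finset.prod_insert hq, if_neg (ne_of_mem_of_not_mem hr hq).symm]

/-- The components of a vector field are recovered from the coordinate functions. -/
theorem fpd_coord (i j : Fin d) :
    fpd i (PowerSeries.C (coord j) : Formal 𝕂 𝕜 d) = if i = j then 1 else 0 := by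
  ext1 n
  rw [coeff_fpd, PowerSeries.coeff_C]
  have h0 : pd i (0 : Smooth 𝕂 𝕜 d) = 0 := (pdHom i).map_zero
  split_ifs with h h' h'
  · rw [pd_coord, if_pos h', h]; simp
  · rw [pd_coord, if_neg h']; simp
  · rw [h0, PowerSeries.coeff_one, if_neg h]
  · rw [h0]; simp

theorem fpd_X_pow_mul (i : Fin d) (k : ℕ) (u : Formal 𝕂 𝕜 d) :
    fpd i (PowerSeries.X ^ k * u) = PowerSeries.X ^ k * fpd i u := by
  ext1 n
  have h0 : pd i (0 : Smooth 𝕂 𝕜 d) = 0 := (pdHom i).map_zero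
  simp only [coeff_fpd, PowerSeries.coeff_X_pow_mul']
  split_ifs <;> simp [h0]

section IteratedDerivatives

variable {V : Type}

theorem iterPd_insert [DecidableEq V] (i : V → Fin d) {s : Finset V} {v : V} (hv : v ∉ s)
    (u : Formal 𝕂 𝕜 d) : iterPd i (insert v s) u = fpd (i v) (iterPd i s u) := by
  simp [iterPd, Finset.insert_val_of_notMem hv]

@[simp]
theorem iterPd_empty (i : V → Fin d) (u : Formal 𝕂 𝕜 d) : iterPd i ∅ u = u := by
  simp [iterPd]

theorem iterPd_singleton (i : V → Fin d) (v : V) (u : Formal 𝕂 𝕜 d) :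
    iterPd i {v} u = fpd (i v) u := by
  simp [iterPd]

theorem iterPd_disjUnion (i : V → Fin d) (s t : Finset V) (h : Disjoint s t)
    (u : Formal 𝕂 𝕜 d) : iterPd i (s.disjUnion t h) u = iterPd i s (iterPd i t u) := by
  simp [iterPd, Finset.disjUnion, Multiset.map_add, Multiset.foldr_add]

theorem iterPd_map {W : Type} (e : V ↪ W) (i : W → Fin d) (s : Finset V) (u : Formal 𝕂 𝕜 d) :
    iterPd i (s.map e) u = iterPd (fun v => i (e v)) s u := by
  simp [iterPd, Finset.map_val, Multiset.map_map]

/-- The iterated partial derivative as a linear map. -/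
def iterPdLin (i : V → Fin d) (s : Finset V) : Formal 𝕂 𝕜 d →ₗ[𝕜] Formal 𝕂 𝕜 d where
  toFun := iterPd i s
  map_add' u v := by
    classical
    induction s using Finset.induction_on with
    | empty => simp
    | insert w s hw ih => simp only [iterPd_insert i hw, ih]; exact (fpdLin (i w)).map_add _ _
  map_smul' c u := by
    classical
    induction s using Finset.induction_on with
    | empty => simp
    | insert w s hw ih => simp only [iterPd_insert i hw, ih]; exact (fpdLin (i w)).map_smul _ _

theorem iterPdLin_apply (i : V → Fin d) (s : Finset V) (u : Formal 𝕂 𝕜 d) :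
    iterPdLin i s u = iterPd i s u := rfl

theorem iterPd_X_pow_mul (i : V → Fin d) (s : Finset V) (k : ℕ) (u : Formal 𝕂 𝕜 d) :
    iterPd i s (PowerSeries.X ^ k * u) = PowerSeries.X ^ k * iterPd i s u := by
  classical
  induction s using Finset.induction_on with
  | empty => simp
  | insert v s hv ih => rw [iterPd_insert i hv, iterPd_insert i hv, ih, fpd_X_pow_mul]

theorem X_pow_dvd_iterPd (i : V → Fin d) (s : Finset V) {k : ℕ} {u : Formal 𝕂 𝕜 d}
    (h : PowerSeries.X ^ k ∣ u) : PowerSeries.X ^ k ∣ iterPd i s u := by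
  obtain ⟨w, rfl⟩ := h
  rw [iterPd_X_pow_mul]
  exact dvd_mul_right _ _

end IteratedDerivatives

end PartialDerivatives

/-! ### Elementary differential operators -/

section ElementaryDifferentials

variable {𝕂 𝕜 : Type*} [RCLike 𝕂] [RCLike 𝕜] [NormedAlgebra 𝕂 𝕜] {d : ℕ}

theorem IsIso.roots_eq {V W : Type} [Fintype V] [Fintype W] {e : V ≃ W} {g : AGraph V}
    {g' : AGraph W} (h : IsIso e g g') : g'.roots = g.roots.map e.toEmbedding := by
  ext w
  obtain ⟨v, rfl⟩ := e.surjective w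
  simp [AGraph.roots, h v]

theorem IsIso.pred_eq {V W : Type} [Fintype V] [Fintype W] [DecidableEq V] [DecidableEq W]
    {e : V ≃ W} {g : AGraph V} {g' : AGraph W} (h : IsIso e g g') (p : V) :
    g'.pred (e p) = (g.pred p).map e.toEmbedding := by
  ext w
  obtain ⟨v, rfl⟩ := e.surjective w
  simp [AGraph.pred, h v]

/-- Isomorphic graphs have the same elementary differential operator. -/
theorem IsIso.elemDiff_eq {V W : Type} [Fintype V] [Fintype W] [DecidableEq V] [DecidableEq W]
    {e : V ≃ W} {g : AGraph V} {g' : AGraph W} (h : IsIso e g g') (f : Fin d → Formal 𝕂 𝕜 d)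
    (G : Formal 𝕂 𝕜 d) : elemDiff f g G = elemDiff f g' G := by
  unfold elemDiff
  rw [← (e.symm.arrowCongr (Equiv.refl (Fin d))).sum_comp]
  refine Finset.sum_congr rfl fun i _ => ?_
  rw [h.roots_eq, iterPd_map, ← e.prod_comp]
  congr 1
  refine Finset.prod_congr rfl fun p _ => ?_
  rw [h.pred_eq, iterPd_map]
  rfl

theorem IsIso.toAF_eq {V W : Type} [Fintype V] [Fintype W] {e : V ≃ W} {g : AGraph V}
    {g' : AGraph W} (h : IsIso e g g') : g.toAF = g'.toAF := by
  refine Quotient.sound ⟨(Fintype.equivFin V).symm.trans (e.trans (Fintype.equivFin W)), ?_⟩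
  intro k
  simp only [Equiv.trans_apply, Equiv.symm_apply_apply]
  rw [h]
  cases g ((Fintype.equivFin V).symm k) <;> simp

theorem exists_iso_of_toAF_eq {V W : Type} [Fintype V] [Fintype W] {g : AGraph V}
    {g' : AGraph W} (h : g.toAF = g'.toAF) : ∃ e : V ≃ W, IsIso e g g' := by
  obtain ⟨e, he⟩ := g.exists_iso_toAF
  obtain ⟨e', he'⟩ : ∃ e' : W ≃ Fin g.toAF.size, IsIso e' g' g.toAF.graph :=
    h ▸ g'.exists_iso_toAF
  exact ⟨_, he.comp he'.symm⟩

@[simp]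
theorem AF.toAF_graph (φ : AF) : φ.graph.toAF = φ := by
  conv_rhs => rw [← Quotient.out_eq φ]
  refine Quotient.sound ⟨(Fintype.equivFin (Fin φ.size)).symm, ?_⟩
  intro k
  have h : ∀ o : Option (Fin φ.size), (o.map (Fintype.equivFin (Fin φ.size))).map
      (Fintype.equivFin (Fin φ.size)).symm = o := by
    intro o
    cases o <;> simp
  exact (h _).symm

theorem AGraph.size_toAF {V : Type} [Fintype V] (g : AGraph V) :
    g.toAF.size = Fintype.card V := by
  obtain ⟨e, -⟩ := g.exists_iso_toAF
  simpa using (Fintype.card_congr e).symm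

theorem elemDiff_graph_toAF {V : Type} [Fintype V] [DecidableEq V] (f : Fin d → Formal 𝕂 𝕜 d)
    (g : AGraph V) (G : Formal 𝕂 𝕜 d) : elemDiff f g.toAF.graph G = elemDiff f g G := by
  obtain ⟨e, he⟩ := g.exists_iso_toAF
  exact (he.elemDiff_eq f G).symm

theorem elemDiff_X_mul {V : Type} [Fintype V] [DecidableEq V] (f : Fin d → Formal 𝕂 𝕜 d)
    (g : AGraph V) (G : Formal 𝕂 𝕜 d) :
    elemDiff (fun j => PowerSeries.X * f j) g G
      = PowerSeries.X ^ Fintype.card V * elemDiff f g G := by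
  unfold elemDiff
  rw [Finset.mul_sum]
  refine Finset.sum_congr rfl fun i _ => ?_
  have h : ∀ p, iterPd i (g.pred p) (PowerSeries.X * f (i p))
      = PowerSeries.X * iterPd i (g.pred p) (f (i p)) := fun p => by
    simpa using iterPd_X_pow_mul i (g.pred p) 1 (f (i p))
  simp only [h, Finset.prod_mul_distrib, Finset.prod_const, Finset.card_univ, mul_assoc]

/-- If `f` has no constant term in `h`, then each node contributes a factor `h`. -/
theorem X_pow_dvd_elemDiff {V : Type} [Fintype V] [DecidableEq V] {f : Fin d → Formal 𝕂 𝕜 d}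
    (hf : ∀ i, PowerSeries.constantCoeff (f i) = 0) (g : AGraph V) (G : Formal 𝕂 𝕜 d) :
    PowerSeries.X ^ Fintype.card V ∣ elemDiff f g G := by
  choose f' hf' using fun i => PowerSeries.X_dvd_iff.2 (hf i)
  obtain rfl : f = fun j => PowerSeries.X * f' j := funext hf'
  rw [elemDiff_X_mul]
  exact dvd_mul_right _ _

end ElementaryDifferentials

/-! ### Sums over aromatic forests as sums over labelled graphs -/

section LabelledSums

/-- The aromatic forests with `n` nodes. -/
def AF.ofSize (n : ℕ) : Finset AF := by
  classical exact Finset.univ.image fun g : AGraph (Fin n) => g.toAF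

theorem AF.exists_graph_of_size {φ : AF} {n : ℕ} (h : φ.size = n) :
    ∃ g : AGraph (Fin n), g.toAF = φ := by
  subst h
  exact ⟨φ.graph, φ.toAF_graph⟩

theorem AF.mem_ofSize {φ : AF} {n : ℕ} : φ ∈ AF.ofSize n ↔ φ.size = n := by
  classical
  simp only [AF.ofSize, Finset.mem_image, Finset.mem_univ, true_and]
  constructor
  · rintro ⟨g, rfl⟩
    simp [AGraph.size_toAF]
  · exact AF.exists_graph_of_size

/-- Orbit counting: an aromatic forest with `n` nodes has `n! / σ` labellings. -/
theorem AF.card_labellings_mul_sigma [DecidableEq AF] {φ : AF} {n : ℕ} (h : φ.size = n) :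
    (Finset.univ.filter fun g : AGraph (Fin n) => g.toAF = φ).card * φ.sigma = n.factorial := by
  classical
  obtain ⟨g₀, hg₀⟩ := AF.exists_graph_of_size h
  -- the action of the permutations on labelled graphs, restricted to the orbit of `g₀`
  let act : Equiv.Perm (Fin n) → AGraph (Fin n) := fun e v => (g₀ (e.symm v)).map e
  have hact : ∀ e g, act e = g ↔ IsIso e g₀ g := by
    intro e g
    constructor
    · rintro rfl v
      simp [act]
    · intro hi
      funext v
      have := hi (e.symm v)
      rw [e.apply_symm_apply] at this
      exact this.symm
  have hmaps : ∀ e ∈ (Finset.univ : Finset (Equiv.Perm (Fin n))),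
      act e ∈ Finset.univ.filter fun g : AGraph (Fin n) => g.toAF = φ := by
    intro e _
    simp only [Finset.mem_filter, Finset.mem_univ, true_and]
    rw [← hg₀]
    exact ((hact e _).1 rfl).toAF_eq.symm
  have hfib : ∀ g ∈ Finset.univ.filter fun g : AGraph (Fin n) => g.toAF = φ,
      (Finset.univ.filter fun e => act e = g).card = φ.sigma := by
    intro g hg
    simp only [Finset.mem_filter, Finset.mem_univ, true_and] at hg
    obtain ⟨e₁, h₁⟩ := exists_iso_of_toAF_eq (g := g₀) (g' := φ.graph) (by simp [hg₀])
    obtain ⟨e₂, h₂⟩ := exists_iso_of_toAF_eq (g := g) (g' := φ.graph) (by simp [hg])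
    rw [AF.sigma, ← Fintype.card_subtype, ← Nat.card_eq_fintype_card]
    refine Nat.card_congr ((Equiv.equivCongr e₁ e₂).subtypeEquiv fun e => ?_)
    rw [hact]
    constructor
    · intro he
      exact (h₁.symm.comp he).comp h₂
    · intro he
      have := (h₁.comp he).comp h₂.symm
      convert this using 1
      ext v
      simp [Equiv.equivCongr]
  have := Finset.card_eq_sum_card_fiberwise hmaps
  rw [Finset.sum_congr rfl hfib, Finset.sum_const, smul_eq_mul, Finset.card_univ,
    Fintype.card_perm, Fintype.card_fin] at this
  exact this.symm

/-- Weighting each aromatic forest by the inverse of its symmetry coefficient amounts to averaging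
over labelled graphs. -/
theorem sum_ofSize_eq_sum_labelled {𝕜 E : Type*} [Field 𝕜] [CharZero 𝕜] [AddCommGroup E]
    [Module 𝕜 E] (n : ℕ) (T : AF → E) :
    ∑ φ ∈ AF.ofSize n, ((φ.sigma : 𝕜)⁻¹) • T φ
      = ((n.factorial : 𝕜)⁻¹) • ∑ g : AGraph (Fin n), T g.toAF := by
  classical
  have h1 : ∑ g : AGraph (Fin n), T g.toAF = ∑ φ ∈ AF.ofSize n,
      (Finset.univ.filter fun g : AGraph (Fin n) => g.toAF = φ).card • T φ := by
    rw [AF.ofSize]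
    exact Finset.sum_comp T fun g : AGraph (Fin n) => g.toAF
  rw [h1, Finset.smul_sum]
  refine Finset.sum_congr rfl fun φ hφ => ?_
  have h2 := AF.card_labellings_mul_sigma (AF.mem_ofSize.1 hφ)
  rw [← Nat.cast_smul_eq_nsmul 𝕜, smul_smul]
  congr 1
  have h3 : (n.factorial : 𝕜) ≠ 0 := Nat.cast_ne_zero.2 n.factorial_ne_zero
  rw [← h2] at h3 ⊢
  push_cast at h3 ⊢
  have h4 := left_ne_zero_of_mul h3
  have h5 := right_ne_zero_of_mul h3
  field_simp

end LabelledSums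

/-! ### Truncations of S-series -/

section Truncation

variable {𝕂 𝕜 : Type*} [RCLike 𝕂] [RCLike 𝕜] [NormedAlgebra 𝕂 𝕜] {d : ℕ}

/-- The part of the S-series on graphs with at most `N` nodes, as an average over labelled
graphs. -/
def sTrunc (N : ℕ) (f : Fin d → Formal 𝕂 𝕜 d) (a : AF → 𝕜) (G : Formal 𝕂 𝕜 d) :
    Formal 𝕂 𝕜 d :=
  ∑ n ∈ Finset.range (N + 1), ((n.factorial : 𝕜)⁻¹) •
    ∑ g : AGraph (Fin n), a g.toAF • elemDiff f g G

theorem coeff_eq_zero_of_X_pow_dvd {u : Formal 𝕂 𝕜 d} {k n : ℕ} (h : PowerSeries.X ^ k ∣ u)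
    (hn : n < k) : PowerSeries.coeff n u = 0 :=
  PowerSeries.X_pow_dvd_iff.1 h n hn

theorem support_coeff_sTerm_subset {f : Fin d → Formal 𝕂 𝕜 d}
    (hf : ∀ i, PowerSeries.constantCoeff (f i) = 0) (a : AF → 𝕜) (G : Formal 𝕂 𝕜 d) (n : ℕ) :
    {φ | PowerSeries.coeff n (sTerm f a G φ) ≠ 0} ⊆ {φ | φ.size ≤ n} := by
  intro φ hφ
  by_contra h
  refine hφ ?_
  have h1 := X_pow_dvd_elemDiff hf φ.graph G
  rw [Fintype.card_fin] at h1
  rw [sTerm, coeff_smul_formal, coeff_eq_zero_of_X_pow_dvd h1 (not_le.1 h), smul_zero]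

theorem AF.coe_biUnion_ofSize [DecidableEq AF] (n : ℕ) :
    ((Finset.range (n + 1)).biUnion AF.ofSize : Set AF) = {φ : AF | φ.size ≤ n} := by
  ext φ
  simp [AF.mem_ofSize]

theorem AF.finite_size_le (n : ℕ) : {φ : AF | φ.size ≤ n}.Finite := by
  classical
  rw [← AF.coe_biUnion_ofSize]
  exact Finset.finite_toSet _

theorem formallySummable_sTerm {f : Fin d → Formal 𝕂 𝕜 d}
    (hf : ∀ i, PowerSeries.constantCoeff (f i) = 0) (a : AF → 𝕜) (G : Formal 𝕂 𝕜 d) :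
    FormallySummable (sTerm f a G) := fun n =>
  (AF.finite_size_le n).subset (support_coeff_sTerm_subset hf a G n)

/-- The coefficients of `h ^ n`, `n ≤ N`, of an S-series only
involve graphs with at most `N` nodes. -/
theorem coeff_sSeries {f : Fin d → Formal 𝕂 𝕜 d}
    (hf : ∀ i, PowerSeries.constantCoeff (f i) = 0) (a : AF → 𝕜) (G : Formal 𝕂 𝕜 d)
    {n N : ℕ} (hn : n ≤ N) :
    PowerSeries.coeff n (sSeries f a G) = PowerSeries.coeff n (sTrunc N f a G) := by
  classical
  have hsub : (Function.support fun φ => PowerSeries.coeff n (sTerm f a G φ))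
      ⊆ ((Finset.range (N + 1)).biUnion AF.ofSize : Finset AF) := by
    rw [AF.coe_biUnion_ofSize]
    exact (support_coeff_sTerm_subset hf a G n).trans fun φ hφ => le_trans hφ hn
  rw [sSeries, formalSum, PowerSeries.coeff_mk, finsum_eq_sum_of_support_subset _ hsub,
    Finset.sum_biUnion, sTrunc, map_sum]
  · refine Finset.sum_congr rfl fun k _ => ?_
    have h := sum_ofSize_eq_sum_labelled (𝕜 := 𝕜) k
      fun φ => a φ • elemDiff f φ.graph G
    simp only [elemDiff_graph_toAF] at h
    rw [← h, map_sum]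
    refine Finset.sum_congr rfl fun φ _ => ?_
    rw [sTerm, smul_smul, div_eq_inv_mul]
  · intro k _ l _ hkl
    rw [Function.onFun, Finset.disjoint_left]
    intro φ hk hl
    exact hkl ((AF.mem_ofSize.1 hk).symm.trans (AF.mem_ofSize.1 hl))

/-- Extension by zero of a function on aromatic trees to aromatic forests. -/
def extendTree (b : AT → 𝕜) (φ : AF) : 𝕜 := by
  classical exact if h : φ.graph.roots.card = 1 then b ⟨φ, h⟩ else 0

theorem extendTree_coe (b : AT → 𝕜) (τ : AT) : extendTree b τ.1 = b τ := by
  rw [extendTree, dif_pos τ.2]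
  rfl

theorem card_roots_toAF {V : Type} [Fintype V] (g : AGraph V) :
    g.toAF.graph.roots.card = g.roots.card := by
  obtain ⟨e, he⟩ := g.exists_iso_toAF
  rw [he.roots_eq, Finset.card_map]

theorem extendTree_eq_zero (b : AT → 𝕜) {V : Type} [Fintype V] {g : AGraph V}
    (h : g.roots.card ≠ 1) : extendTree b g.toAF = 0 := by
  rw [extendTree, dif_neg]
  rwa [card_roots_toAF]

/-- A B-series is the S-series of the coefficients extended by zero, applied to the coordinate
functions. -/
theorem bSeries_eq_sSeries (f : Fin d → Formal 𝕂 𝕜 d) (b : AT → 𝕜) (j : Fin d) :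
    bSeries f b j = sSeries f (extendTree b) (PowerSeries.C (coord j)) := by
  rw [bSeries, sSeries, formalSum, formalSum]
  ext1 n
  rw [PowerSeries.coeff_mk, PowerSeries.coeff_mk]
  have h1 : ∀ τ : AT, bTerm f b j τ = sTerm f (extendTree b) (PowerSeries.C (coord j)) τ.1 :=
    fun τ => by rw [bTerm, sTerm, extendTree_coe]
  simp only [h1]
  refine (finsum_subtype_eq_finsum_cond (f := fun φ => PowerSeries.coeff n
    (sTerm f (extendTree b) (PowerSeries.C (coord j)) φ)) fun φ => φ.graph.roots.card = 1).trans
    (finsum_congr fun φ => ?_)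
  by_cases h : φ.graph.roots.card = 1
  · simp [h]
  · simp [h, sTerm, extendTree]

theorem formallySummable_bTerm {f : Fin d → Formal 𝕂 𝕜 d}
    (hf : ∀ i, PowerSeries.constantCoeff (f i) = 0) (b : AT → 𝕜) (j : Fin d) :
    FormallySummable (bTerm f b j) := by
  intro n
  refine Set.Finite.subset (((formallySummable_sTerm hf (extendTree b)
    (PowerSeries.C (coord j))) n).preimage (Subtype.val_injective.injOn)) fun τ hτ => ?_
  change PowerSeries.coeff n (sTerm _ _ _ τ.1) ≠ 0
  rw [sTerm, extendTree_coe b (show AT from τ)]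
  exact hτ

/-- The empty forest is not a tree, so that `S_{B_f(b)}` makes sense. -/
theorem constantCoeff_bSeries {f : Fin d → Formal 𝕂 𝕜 d}
    (hf : ∀ i, PowerSeries.constantCoeff (f i) = 0) (b : AT → 𝕜) (j : Fin d) :
    PowerSeries.constantCoeff (bSeries f b j) = 0 := by
  rw [bSeries_eq_sSeries, ← PowerSeries.coeff_zero_eq_constantCoeff_apply,
    coeff_sSeries hf _ _ (le_refl 0), sTrunc]
  have h : ∀ g : AGraph (Fin 0), extendTree b g.toAF = 0 := fun g =>
    extendTree_eq_zero b (by simp [AGraph.roots])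
  simp [h]

end Truncation

/-! ### Products of exponential generating functions -/

section ExponentialGeneratingFunctions

variable {𝕜 R M : Type*} [Field 𝕜] [CharZero 𝕜] [CommRing R] [Algebra 𝕜 R] [Fintype M]
  [DecidableEq M]

/-- The maps `Fin n → M` with prescribed sizes `κ` of the fibres are counted by the multinomial
coefficient of `κ`. -/
theorem sum_prod_card_fiber (n : ℕ) (α : M → ℕ → R) :
    ∑ c : Fin n → M, ∏ v, α v (Finset.univ.filter fun i => c i = v).card
      = ∑ κ ∈ Finset.piAntidiag Finset.univ n,
          Nat.multinomial Finset.univ κ • ∏ v, α v (κ v) := by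
  -- compare the two expansions of `(∑ X_v)ⁿ` under the linear functional which sends the monomial
  -- of exponent `κ` to `∏ α v (κ v)`
  let L : MvPolynomial M ℤ →ₗ[ℤ] R :=
    (MvPolynomial.basisMonomials M ℤ).constr ℤ fun κ => ∏ v, α v (κ v)
  have hL : ∀ κ : M →₀ ℕ, L (MvPolynomial.monomial κ 1) = ∏ v, α v (κ v) := by
    intro κ
    have := (MvPolynomial.basisMonomials M ℤ).constr_basis ℤ (fun κ => ∏ v, α v (κ v)) κ
    rwa [MvPolynomial.coe_basisMonomials] at this
  have h1 : (∑ v, MvPolynomial.X v : MvPolynomial M ℤ) ^ n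
      = ∑ c : Fin n → M, MvPolynomial.monomial (∑ i, Finsupp.single (c i) 1) 1 := by
    rw [Fintype.sum_pow]
    refine Finset.sum_congr rfl fun c _ => ?_
    rw [MvPolynomial.monomial_sum_one]
    rfl
  have h2 : (∑ v, MvPolynomial.X v : MvPolynomial M ℤ) ^ n
      = ∑ κ ∈ Finset.piAntidiag Finset.univ n, Nat.multinomial Finset.univ κ •
          MvPolynomial.monomial (Finsupp.equivFunOnFinite.symm κ) 1 := by
    rw [Finset.sum_pow_eq_sum_piAntidiag]
    refine Finset.sum_congr rfl fun κ _ => ?_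
    rw [MvPolynomial.monomial_eq, Finsupp.prod_fintype _ _ (fun _ => pow_zero _), nsmul_eq_mul]
    simp
  have h3 := congrArg L (h1.symm.trans h2)
  simp only [map_sum, map_nsmul, hL] at h3
  have h4 : ∀ (c : Fin n → M) (v : M), (∑ i, Finsupp.single (c i) 1 : M →₀ ℕ) v
      = (Finset.univ.filter fun i => c i = v).card := fun c v => by
    simp [Finsupp.single_apply]
  simp only [h4] at h3
  exact h3

/-- The product of truncated exponential generating functions, modulo the powers of `x` that the
truncation neglects. -/
theorem X_pow_dvd_prod_sum_sub (x : R) (α : M → ℕ → R) (hα : ∀ v k, x ^ k ∣ α v k) (N : ℕ) :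
    x ^ (N + 1) ∣ (∏ v, ∑ k ∈ Finset.range (N + 1), ((k.factorial : 𝕜)⁻¹) • α v k)
      - ∑ n ∈ Finset.range (N + 1), ((n.factorial : 𝕜)⁻¹) •
          ∑ c : Fin n → M, ∏ v, α v (Finset.univ.filter fun i => c i = v).card := by
  let t : (M → ℕ) → R := fun κ => ∏ v, (((κ v).factorial : 𝕜)⁻¹) • α v (κ v)
  let S : Finset (M → ℕ) := Fintype.piFinset fun _ => Finset.range (N + 1)
  have h1 : (∏ v, ∑ k ∈ Finset.range (N + 1), ((k.factorial : 𝕜)⁻¹) • α v k) = ∑ κ ∈ S, t κ :=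
    Finset.prod_univ_sum _ _
  have h2 : ∀ n ∈ Finset.range (N + 1), ((n.factorial : 𝕜)⁻¹) •
      ∑ c : Fin n → M, ∏ v, α v (Finset.univ.filter fun i => c i = v).card
      = ∑ κ ∈ (S.filter fun κ => ∑ v, κ v ≤ N) with ∑ v, κ v = n, t κ := by
    intro n hn
    -- all `κ` of total size `n ≤ N` satisfy the truncation `κ v ≤ N`
    rw [sum_prod_card_fiber, Finset.smul_sum]
    refine Finset.sum_congr ?_ fun κ hκ => ?_
    · ext κ
      simp only [Finset.mem_piAntidiag, Finset.mem_univ, implies_true, and_true, Finset.mem_filter,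
        S, Fintype.mem_piFinset, Finset.mem_range] at hn ⊢
      constructor
      · intro h
        change ∑ v, κ v = n at h
        refine ⟨⟨fun v => ?_, by omega⟩, h⟩
        have : κ v ≤ ∑ v, κ v :=
          Finset.single_le_sum (f := κ) (fun _ _ => Nat.zero_le _) (Finset.mem_univ v)
        omega
      · exact fun h => h.2
    · have hs : ∑ v, κ v = n := (Finset.mem_filter.1 hκ).2
      have hm := Nat.multinomial_spec Finset.univ κ
      rw [hs] at hm
      have ht : t κ = (∏ v, (((κ v).factorial : 𝕜)⁻¹)) • ∏ v, α v (κ v) :=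
        Finset.prod_smul _ _ _
      rw [ht, ← Nat.cast_smul_eq_nsmul 𝕜, smul_smul]
      congr 1
      have h3 : (n.factorial : 𝕜) ≠ 0 := Nat.cast_ne_zero.2 n.factorial_ne_zero
      rw [← hm] at h3 ⊢
      push_cast at h3 ⊢
      have h4 := left_ne_zero_of_mul h3
      have h5 := right_ne_zero_of_mul h3
      rw [Finset.prod_inv_distrib]
      field_simp
  rw [h1, Finset.sum_congr rfl h2, Finset.sum_fiberwise_of_maps_to (fun κ hκ =>
    Finset.mem_range.2 (Nat.lt_succ_of_le (Finset.mem_filter.1 hκ).2)),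
    ← Finset.sum_filter_add_sum_filter_not S (fun κ => ∑ v, κ v ≤ N), add_sub_cancel_left]
  refine Finset.dvd_sum fun κ hκ => ?_
  have hle : N + 1 ≤ ∑ v, κ v := by
    have := (Finset.mem_filter.1 hκ).2
    omega
  refine (pow_dvd_pow x hle).trans ?_
  rw [← Finset.prod_pow_eq_pow_sum]
  refine Finset.prod_dvd_prod_of_dvd _ _ fun v _ => ?_
  rw [Algebra.smul_def]
  exact (hα v _).mul_left _

end ExponentialGeneratingFunctions

section Congruence

variable {𝕂 𝕜 : Type*} [RCLike 𝕂] [RCLike 𝕜] [NormedAlgebra 𝕂 𝕜] {d : ℕ}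

/-- The elementary differential operator, modulo a power of `h`, depends only on the vector field
modulo this power. -/
theorem X_pow_dvd_elemDiff_sub {V : Type} [Fintype V] [DecidableEq V] {k : ℕ}
    {F F' : Fin d → Formal 𝕂 𝕜 d} (h : ∀ j, PowerSeries.X ^ k ∣ F j - F' j) (g : AGraph V)
    (G : Formal 𝕂 𝕜 d) : PowerSeries.X ^ k ∣ elemDiff F g G - elemDiff F' g G := by
  rw [← Ideal.mem_span_singleton, ← Ideal.Quotient.eq]
  unfold elemDiff
  simp only [map_sum, map_mul, map_prod]
  refine Finset.sum_congr rfl fun i _ => ?_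
  congr 1
  refine Finset.prod_congr rfl fun p _ => ?_
  rw [Ideal.Quotient.eq, Ideal.mem_span_singleton, ← iterPdLin_apply, ← iterPdLin_apply, ← map_sub]
  exact X_pow_dvd_iterPd _ _ (h _)

end Congruence

/-! ### The Leibniz rule for grafting -/

section Leibniz

variable {𝕂 𝕜 : Type*} [RCLike 𝕂] [RCLike 𝕜] [NormedAlgebra 𝕂 𝕜] {d : ℕ}

theorem iterPd_filter_succ {m : ℕ} (u : Fin (m + 1) → Fin d) (P : Fin (m + 1) → Prop)
    [DecidablePred P] (Y : Formal 𝕂 𝕜 d) :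
    iterPd u (Finset.univ.filter P) Y
      = iterPd (fun e => u (Fin.succ e)) (Finset.univ.filter fun e : Fin m => P e.succ)
          (if P 0 then fpd (u 0) Y else Y) := by
  have hmap := iterPd_map (Fin.succEmb m) u (Finset.univ.filter fun e : Fin m => P e.succ)
    (if P 0 then fpd (u 0) Y else Y)
  rw [Fin.coe_succEmb] at hmap
  rw [← hmap]
  by_cases h : P 0
  · rw [if_pos h, ← iterPd_singleton (i := u), ← iterPd_disjUnion]
    · congr 1
      ext e
      cases e using Fin.cases <;> simp [h]
    · simp
  · rw [if_neg h]
    congr 1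
    ext e
    cases e using Fin.cases <;> simp [h]

/-- The general Leibniz rule for several products: the factors `X p` are grouped by `c : P → Q`,
the derivative with index `e` acts on the group `tgt e`, and each derivative chooses a factor of
its group on which to act. -/
theorem prod_iterPd_prod {P Q : Type} [Fintype P] [Fintype Q] [DecidableEq P] [DecidableEq Q]
    (c : P → Q) {m : ℕ} (u : Fin m → Fin d) (tgt : Fin m → Q) (X : P → Formal 𝕂 𝕜 d) :
    ∏ q, iterPd u (Finset.univ.filter fun e => tgt e = q)
        (∏ p ∈ Finset.univ.filter (fun p => c p = q), X p)
      = ∑ a : Fin m → P, if (∀ e, c (a e) = tgt e) then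
          ∏ p, iterPd u (Finset.univ.filter fun e => a e = p) (X p) else 0 := by
  induction m generalizing X with
  | zero =>
    simp [Finset.prod_fiberwise]
  | succ m ih =>
    have hstep : ∀ q, iterPd u (Finset.univ.filter fun e => tgt e = q)
        (∏ p ∈ Finset.univ.filter (fun p => c p = q), X p)
        = iterPd (fun e => u (Fin.succ e)) (Finset.univ.filter fun e : Fin m => tgt e.succ = q)
          (if tgt 0 = q then ∑ r ∈ Finset.univ.filter (fun p => c p = q),
              ∏ p ∈ Finset.univ.filter (fun p => c p = q),
                if p = r then fpd (u 0) (X p) else X p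
            else ∏ p ∈ Finset.univ.filter (fun p => c p = q), X p) := by
      intro q
      rw [iterPd_filter_succ, fpd_prod]
    -- the derivative with index `0` chooses the factor `r`
    have hsum : ∏ q, iterPd u (Finset.univ.filter fun e => tgt e = q)
        (∏ p ∈ Finset.univ.filter (fun p => c p = q), X p)
        = ∑ r ∈ Finset.univ.filter (fun p => c p = tgt 0), ∏ q,
          iterPd (fun e => u (Fin.succ e)) (Finset.univ.filter fun e : Fin m => tgt e.succ = q)
            (∏ p ∈ Finset.univ.filter (fun p => c p = q),
              if p = r then fpd (u 0) (X p) else X p) := by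
      rw [← Finset.mul_prod_erase _ _ (Finset.mem_univ (tgt 0)), hstep, if_pos rfl,
        ← iterPdLin_apply, map_sum, Finset.sum_mul]
      refine Finset.sum_congr rfl fun r hr => ?_
      rw [← Finset.mul_prod_erase Finset.univ _ (Finset.mem_univ (tgt 0)), iterPdLin_apply]
      congr 1
      refine Finset.prod_congr rfl fun q hq => ?_
      have hq' : tgt 0 ≠ q := (Finset.ne_of_mem_erase hq).symm
      rw [hstep, if_neg hq']
      congr 1
      refine Finset.prod_congr rfl fun p hp => ?_
      rw [if_neg]
      rintro rfl
      exact hq' ((Finset.mem_filter.1 hr).2.symm.trans (Finset.mem_filter.1 hp).2)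
    rw [hsum, ← (Fin.consEquiv fun _ => P).sum_comp, Fintype.sum_prod_type, Finset.sum_filter]
    refine Finset.sum_congr rfl fun r _ => ?_
    by_cases hr : c r = tgt 0
    · rw [if_pos hr, ih]
      refine Finset.sum_congr rfl fun a _ => ?_
      simp only [Fin.consEquiv_apply, Fin.forall_fin_succ, Fin.cons_zero, Fin.cons_succ, hr,
        true_and]
      congr 1
      refine Finset.prod_congr rfl fun p _ => ?_
      rw [iterPd_filter_succ]
      simp only [Fin.cons_zero, Fin.cons_succ, eq_comm (a := p) (b := r)]
    · rw [if_neg hr, Finset.sum_eq_zero]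
      intro a _
      rw [if_neg]
      intro h
      exact hr (by simpa using h 0)

end Leibniz

theorem AGraph.mem_pred {V : Type} [Fintype V] [DecidableEq V] {g : AGraph V} {p q : V} :
    q ∈ g.pred p ↔ g q = some p := by
  simp [AGraph.pred]

/-! ### Vertex sets covered by labelled trees -/

/-- A family, indexed by `M`, of aromatic trees whose vertex sets partition `V`: the tree with
label `m` lives on the fibre `block ⁻¹ m`, and `kept` is the union of the trees. This is a
partition into aromatic trees with labelled blocks, without reference to an ambient graph. -/
@[ext]
structure TreeCover (V M : Type) where
  block : V → M
  kept : AGraph V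
  block_kept : ∀ v w, kept v = some w → block w = block v
  one_root : ∀ m, ∃! v, block v = m ∧ kept v = none

namespace TreeCover

variable {V M : Type} (L : TreeCover V M)

/-- The root of the tree with label `m`. -/
def root (m : M) : V := (L.one_root m).choose

@[simp]
theorem block_root (m : M) : L.block (L.root m) = m := (L.one_root m).choose_spec.1.1

@[simp]
theorem kept_root (m : M) : L.kept (L.root m) = none := (L.one_root m).choose_spec.1.2

theorem root_block {v : V} (h : L.kept v = none) : L.root (L.block v) = v :=
  (L.one_root (L.block v)).unique ⟨L.block_root _, L.kept_root _⟩ ⟨rfl, h⟩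

/-- The roots, as an embedding of the labels into the vertices. -/
def rootEmb : M ↪ V := ⟨L.root, Function.LeftInverse.injective L.block_root⟩

/-- The tree with label `m`. -/
def sub (m : M) : AGraph {v // L.block v = m} :=
  fun v => Option.pmap (fun w hw => ⟨w, hw⟩) (L.kept v.1)
    (fun _ h => (L.block_kept _ _ h).trans v.2)

theorem map_val_sub (m : M) (v : {v // L.block v = m}) :
    (L.sub m v).map Subtype.val = L.kept v.1 := by
  rw [sub, Option.map_pmap]
  simp

theorem sub_eq_some_iff (m : M) (v w : {v // L.block v = m}) :
    L.sub m v = some w ↔ L.kept v.1 = some w.1 := by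
  rw [← L.map_val_sub]
  constructor
  · intro h; rw [h]; rfl
  · intro h
    obtain ⟨w', hw', hw⟩ := Option.map_eq_some_iff.1 h
    rw [hw', Subtype.ext hw]

theorem sub_eq_none_iff (m : M) (v : {v // L.block v = m}) :
    L.sub m v = none ↔ L.kept v.1 = none := by
  rw [← L.map_val_sub, Option.map_eq_none_iff]

theorem roots_sub [Fintype V] [DecidableEq M] (m : M) :
    (L.sub m).roots = {⟨L.root m, L.block_root m⟩} := by
  ext v
  simp only [AGraph.roots, Finset.mem_filter, Finset.mem_univ, true_and, Option.isNone_iff_eq_none,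
    Finset.mem_singleton, sub_eq_none_iff]
  constructor
  · intro h
    have := L.root_block h
    rw [v.2] at this
    exact Subtype.ext this.symm
  · rintro rfl
    simp

theorem pred_sub [Fintype V] [DecidableEq V] [DecidableEq M] (m : M)
    (v : {v // L.block v = m}) :
    ((L.sub m).pred v).map (Function.Embedding.subtype _) = AGraph.pred L.kept v.1 := by
  ext w
  simp only [AGraph.pred, Finset.mem_map, Finset.mem_filter, Finset.mem_univ, true_and,
    Function.Embedding.coe_subtype, sub_eq_some_iff]
  constructor
  · rintro ⟨w', h, rfl⟩
    exact h
  · intro h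
    exact ⟨⟨w, (L.block_kept _ _ h).symm.trans v.2⟩, h, rfl⟩

/-- The graph obtained from the trees by adding an edge from the root with label `m` to `ext m`. -/
def graft (ext : M → Option V) : AGraph V := fun v => (L.kept v).or (ext (L.block v))

theorem graft_root (ext : M → Option V) (m : M) : L.graft ext (L.root m) = ext m := by
  simp [graft]

theorem roots_graft [Fintype V] [Fintype M] (ext : M → Option V) :
    (L.graft ext).roots
      = (Finset.univ.filter fun m => ext m = none).map L.rootEmb := by
  ext v
  simp only [AGraph.roots, Finset.mem_filter, Finset.mem_univ, true_and, Option.isNone_iff_eq_none,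
    Finset.mem_map, graft, Option.or_eq_none_iff]
  constructor
  · rintro ⟨h1, h2⟩
    exact ⟨_, h2, L.root_block h1⟩
  · rintro ⟨m, h, rfl⟩
    exact ⟨L.kept_root m, (congrArg ext (L.block_root m)).trans h⟩

/-- The incoming edges of `p` are those of its tree and those attached to `p`. -/
theorem pred_graft [Fintype V] [DecidableEq V] [Fintype M] (ext : M → Option V) (p : V) :
    ∃ h, AGraph.pred (L.graft ext) p
      = ((Finset.univ.filter fun m => ext m = some p).map L.rootEmb).disjUnion
          (AGraph.pred L.kept p) h := by
  refine ⟨?_, ?_⟩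
  · rw [Finset.disjoint_left]
    intro v h1 h2
    obtain ⟨m, -, rfl⟩ := Finset.mem_map.1 h1
    have h3 : L.kept (L.root m) = some p := (Finset.mem_filter.1 h2).2
    simp at h3
  · ext v
    rw [Finset.mem_disjUnion, AGraph.mem_pred, AGraph.mem_pred, graft]
    simp only [Finset.mem_map, Finset.mem_filter, Finset.mem_univ, true_and]
    cases hv : L.kept v with
    | none =>
      simp only [Option.none_or, reduceCtorEq, or_false]
      constructor
      · intro h
        exact ⟨_, h, L.root_block hv⟩
      · rintro ⟨m, h, rfl⟩
        exact (congrArg ext (L.block_root m)).trans h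
    | some w =>
      simp only [Option.some_or]
      constructor
      · intro h
        exact Or.inr h
      · rintro (⟨m, -, rfl⟩ | h)
        · have := hv.symm.trans (L.kept_root m)
          simp at this
        · exact h

end TreeCover

/-! ### Composition of elementary differential operators -/

section Composition

variable {𝕂 𝕜 : Type*} [RCLike 𝕂] [RCLike 𝕜] [NormedAlgebra 𝕂 𝕜] {d : ℕ}

/-- A product over labels of sums over functions on the fibres is a sum over functions. -/
theorem prod_sum_fiber {V M A R : Type*} [Fintype V] [DecidableEq V] [Fintype M] [DecidableEq M]
    [Fintype A] [CommSemiring R] (c : V → M) (Θ : ∀ m, ({v // c v = m} → A) → R) :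
    ∏ m, ∑ x : {v // c v = m} → A, Θ m x = ∑ x : V → A, ∏ m, Θ m (fun v => x v.1) := by
  rw [Finset.prod_univ_sum, Fintype.piFinset_univ]
  let E : (V → A) ≃ (∀ m, {v // c v = m} → A) :=
    ((Equiv.sigmaFiberEquiv c).symm.arrowCongr (Equiv.refl A)).trans
      (Equiv.piCurry fun (m : M) (_ : {v // c v = m}) => A)
  rw [← E.sum_comp]
  rfl

/-- Component `k` of the vector field of a tree: the root carries the index `k`. -/
theorem elemDiff_sub_coord {V M : Type} [Fintype V] [DecidableEq V] [DecidableEq M]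
    (L : TreeCover V M) (f : Fin d → Formal 𝕂 𝕜 d) (m : M) (k : Fin d) :
    elemDiff f (L.sub m) (PowerSeries.C (coord k))
      = ∑ i : {v // L.block v = m} → Fin d, if i ⟨L.root m, L.block_root m⟩ = k then
          ∏ p, iterPd i ((L.sub m).pred p) (f (i p)) else 0 := by
  unfold elemDiff
  refine Finset.sum_congr rfl fun i _ => ?_
  rw [L.roots_sub, iterPd_singleton, fpd_coord, mul_ite, mul_one, mul_zero]

/-- Let each node `m` of the graph `s` carry the vector field given by the tree with label `m`.
The differential operator of `s` is then the sum of the operators of the graphs in which each edge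
of `s` out of `m` has been attached to some node of the tree at its end. -/
theorem sum_elemDiff_sub {V : Type} [Fintype V] [DecidableEq V] {m : ℕ}
    (L : TreeCover V (Fin m)) (s : AGraph (Fin m)) (f : Fin d → Formal 𝕂 𝕜 d)
    (G : Formal 𝕂 𝕜 d) :
    ∑ j : Fin m → Fin d, (∏ v, iterPd j (s.pred v)
        (elemDiff f (L.sub v) (PowerSeries.C (coord (j v))))) * iterPd j s.roots G
      = ∑ ext : Fin m → Option V, if (∀ e, (ext e).map L.block = s e) then
          elemDiff f (L.graft ext) G else 0 := by
  let X : (V → Fin d) → V → Formal 𝕂 𝕜 d :=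
    fun i p => iterPd i (AGraph.pred L.kept p) (f (i p))
  -- collect the index functions of the trees into one index function on `V`
  have h1 : ∀ j : Fin m → Fin d, (∏ v, iterPd j (s.pred v)
      (elemDiff f (L.sub v) (PowerSeries.C (coord (j v))))) * iterPd j s.roots G
      = ∑ i : V → Fin d, if (fun v => i (L.root v)) = j then
        (∏ v, iterPd j (s.pred v) (∏ p ∈ Finset.univ.filter (fun p => L.block p = v), X i p))
          * iterPd j s.roots G else 0 := by
    intro j
    simp only [elemDiff_sub_coord, ← iterPdLin_apply j, map_sum]
    rw [prod_sum_fiber, Finset.sum_mul]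
    refine Finset.sum_congr rfl fun i _ => ?_
    have h2 : ∀ v, (∏ p : {p // L.block p = v}, iterPd (fun q : {p // L.block p = v} => i q.1)
        ((L.sub v).pred p) (f (i p.1)))
        = ∏ p ∈ Finset.univ.filter (fun p => L.block p = v), X i p := by
      intro v
      rw [Finset.prod_subtype (p := fun p => L.block p = v) _ (by simp) (X i)]
      refine Finset.prod_congr rfl fun p _ => ?_
      simp only [X]
      rw [← L.pred_sub, iterPd_map]
      rfl
    simp only [h2]
    by_cases hj : (fun v => i (L.root v)) = j
    · subst hj
      simp
    · rw [if_neg hj]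
      obtain ⟨v, hv⟩ := Function.ne_iff.1 hj
      rw [Finset.prod_eq_zero (Finset.mem_univ v), zero_mul]
      rw [if_neg hv, map_zero]
  simp only [h1]
  rw [Finset.sum_comm]
  simp only [Finset.sum_ite_eq, Finset.mem_univ, if_true]
  -- let the derivatives choose the factors on which they act
  have h3 : ∀ i : V → Fin d, (∏ v, iterPd (fun v => i (L.root v)) (s.pred v)
      (∏ p ∈ Finset.univ.filter (fun p => L.block p = v), X i p))
        * iterPd (fun v => i (L.root v)) s.roots G
      = ∑ ext : Fin m → Option V, if (∀ e, (ext e).map L.block = s e) then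
          (∏ p, iterPd i (AGraph.pred (L.graft ext) p) (f (i p)))
            * iterPd i (L.graft ext).roots G else 0 := by
    intro i
    -- the roots of `s` are the edges with target `none`, and `G` is the factor at `none`
    have h4 := prod_iterPd_prod (Option.map L.block) (fun v => i (L.root v)) s
      (fun p => p.elim G (X i))
    simp only [Fintype.prod_option, Finset.prod_filter, Option.map_none, Option.map_some,
      Option.elim, Option.some_inj, if_true, reduceCtorEq, if_false, Finset.prod_const_one,
      mul_one, one_mul] at h4
    have h5 : s.roots = Finset.univ.filter fun e => s e = none := by
      simp [AGraph.roots]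
    rw [h5, mul_comm]
    simp only [Finset.prod_filter, AGraph.pred] at h4 ⊢
    rw [h4]
    refine Finset.sum_congr rfl fun ext _ => ?_
    congr 1
    rw [L.roots_graft, iterPd_map, mul_comm]
    congr 1
    refine Finset.prod_congr rfl fun p _ => ?_
    obtain ⟨hd, hp⟩ := L.pred_graft ext p
    change _ = iterPd i (AGraph.pred (L.graft ext) p) _
    rw [hp, iterPd_disjUnion, iterPd_map]
    rfl
  simp only [h3]
  rw [Finset.sum_comm]
  refine Finset.sum_congr rfl fun ext _ => ?_
  by_cases h : ∀ e, (ext e).map L.block = s e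
  · simp only [if_pos h]
    rfl
  · simp only [if_neg h, Finset.sum_const_zero]

end Composition

/-! ### Sums over tree covers -/

/-- Transport of graphs along a bijection of the vertex sets. -/
def AGraph.congr {V W : Type} (e : V ≃ W) : AGraph V ≃ AGraph W :=
  e.arrowCongr (Equiv.optionCongr e)

theorem AGraph.isIso_congr {V W : Type} (e : V ≃ W) (g : AGraph V) :
    IsIso e g (AGraph.congr e g) := by
  intro v
  simp [AGraph.congr]

namespace TreeCover

variable {V M : Type}

instance [Fintype V] [Fintype M] : Fintype (TreeCover V M) := by
  classical
  exact Fintype.ofInjective (β := (V → M) × (V → Option V)) (fun L => (L.block, L.kept)) (by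
    intro L L' h
    simp only [Prod.mk.injEq] at h
    exact TreeCover.ext h.1 h.2)

/-- The union of a family of graphs on the fibres of a map `V → M`. The map and the family form one
argument, so that equalities of such pairs can be used without casts. -/
def unionKept (x : Σ c : V → M, ∀ m, AGraph {v // c v = m}) : AGraph V :=
  fun v => (x.2 (x.1 v) ⟨v, rfl⟩).map Subtype.val

theorem unionKept_of_eq (x : Σ c : V → M, ∀ m, AGraph {v // c v = m}) (m : M)
    (v : {v // x.1 v = m}) : unionKept x v.1 = (x.2 m v).map Subtype.val := by
  obtain ⟨v, rfl⟩ := v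
  rfl

/-- A tree cover is determined by its blocks and its trees. -/
theorem unionKept_sub (L : TreeCover V M) : unionKept ⟨L.block, L.sub⟩ = L.kept := by
  funext v
  exact L.map_val_sub (L.block v) ⟨v, rfl⟩

/-- Every family of trees on the fibres of a map comes from a tree cover. -/
theorem exists_sub_eq [Fintype V] [DecidableEq M] (c : V → M) (t : ∀ m, AGraph {v // c v = m})
    (h : ∀ m, (t m).roots.card = 1) :
    ∃ L : TreeCover V M, (⟨L.block, L.sub⟩ : Σ c : V → M, ∀ m, AGraph {v // c v = m}) = ⟨c, t⟩ := by
  let L : TreeCover V M :=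
    { block := c
      kept := unionKept ⟨c, t⟩
      block_kept := by
        intro v w hvw
        obtain ⟨w', -, rfl⟩ := Option.map_eq_some_iff.1 hvw
        exact w'.2
      one_root := by
        intro m
        obtain ⟨r, hr⟩ := Finset.card_eq_one.1 (h m)
        have hroot : ∀ v : {v // c v = m}, unionKept ⟨c, t⟩ v.1 = none ↔ v = r := by
          intro v
          rw [unionKept_of_eq ⟨c, t⟩ m v, Option.map_eq_none_iff]
          have h1 : v ∈ (t m).roots ↔ t m v = none := by simp [AGraph.roots]
          exact h1.symm.trans (by rw [hr, Finset.mem_singleton])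
        refine ⟨r.1, ⟨r.2, (hroot r).2 rfl⟩, ?_⟩
        rintro v ⟨hv, hk⟩
        exact congrArg Subtype.val ((hroot ⟨v, hv⟩).1 hk) }
  refine ⟨L, Sigma.ext rfl (heq_of_eq ?_)⟩
  funext m v
  apply Option.map_injective Subtype.val_injective
  rw [L.map_val_sub]
  exact unionKept_of_eq ⟨c, t⟩ m v

/-- A sum over maps `c : V → M` and families of graphs on the fibres reduces to a sum over tree
covers, if only the families of trees contribute. -/
theorem sum_block_sub {E : Type*} [AddCommMonoid E] [Fintype V] [DecidableEq V] [Fintype M]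
    [DecidableEq M] (H : ∀ c : V → M, (∀ m, AGraph {v // c v = m}) → E)
    (hH : ∀ c t m, (t m).roots.card ≠ 1 → H c t = 0) :
    ∑ c : V → M, ∑ t : ∀ m, AGraph {v // c v = m}, H c t
      = ∑ L : TreeCover V M, H L.block L.sub := by
  rw [← Fintype.sum_sigma' (fun (c : V → M) (t : ∀ m, AGraph {v // c v = m}) => H c t)]
  symm
  refine Finset.sum_of_injOn (fun L : TreeCover V M =>
    (⟨L.block, L.sub⟩ : Σ c : V → M, ∀ m, AGraph {v // c v = m})) ?_ (fun _ _ => by simp) ?_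
    (fun _ _ => rfl)
  · intro L _ L' _ h
    have h' : (⟨L.block, L.sub⟩ : Σ c : V → M, ∀ m, AGraph {v // c v = m})
      = ⟨L'.block, L'.sub⟩ := h
    refine TreeCover.ext (congrArg Sigma.fst h') ?_
    rw [← L.unionKept_sub, h', L'.unionKept_sub]
  · rintro ⟨c, t⟩ - hnot
    by_contra hne
    refine hnot ?_
    obtain ⟨L, hL⟩ := exists_sub_eq c t fun m => by
      by_contra hm
      exact hne (hH c t m hm)
    exact ⟨L, by simp, hL⟩

/-- The edges of the trees are edges of `g`. -/
def Le (L : TreeCover V M) (g : AGraph V) : Prop := ∀ v, L.kept v = none ∨ L.kept v = g v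

/-- The skeleton: the trees collapsed to single nodes. -/
def skel (L : TreeCover V M) (g : AGraph V) : AGraph M := fun m => (g (L.root m)).map L.block

theorem le_graft (L : TreeCover V M) (ext : M → Option V) : L.Le (L.graft ext) := by
  intro v
  rw [graft]
  cases L.kept v <;> simp

theorem skel_graft (L : TreeCover V M) (ext : M → Option V) (m : M) :
    L.skel (L.graft ext) m = (ext m).map L.block := by
  rw [skel, graft_root]

theorem graft_comp_root (L : TreeCover V M) {g : AGraph V} (h : L.Le g) :
    L.graft (fun m => g (L.root m)) = g := by
  funext v
  rw [graft]
  rcases h v with h0 | h1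
  · rw [h0, Option.none_or, L.root_block h0]
  · cases hv : L.kept v with
    | none => rw [Option.none_or, L.root_block hv]
    | some w => rw [Option.some_or, ← h1, hv]

/-- Grafting enumerates the graphs which contain the given trees. -/
theorem sum_graft {E : Type*} [AddCommMonoid E] [Fintype V] [DecidableEq V] [Fintype M]
    [DecidableEq M] (L : TreeCover V M) [DecidablePred L.Le] (Φ : AGraph V → E) :
    ∑ ext : M → Option V, Φ (L.graft ext) = ∑ g : AGraph V, if L.Le g then Φ g else 0 := by
  rw [← Finset.sum_filter]
  refine Finset.sum_nbij' L.graft (fun g m => g (L.root m)) ?_ (by simp) ?_ ?_ (fun _ _ => rfl)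
  · intro ext _
    simp [L.le_graft]
  · intro ext _
    funext m
    exact L.graft_root ext m
  · intro g hg
    exact L.graft_comp_root (Finset.mem_filter.1 hg).2

/-- Transport of tree covers along a bijection of the vertex sets. -/
def congr {W : Type} (e : V ≃ W) (L : TreeCover V M) : TreeCover W M where
  block w := L.block (e.symm w)
  kept := AGraph.congr e L.kept
  block_kept := by
    intro v w h
    have h' : (L.kept (e.symm v)).map e = some w := h
    obtain ⟨u, hu, rfl⟩ := Option.map_eq_some_iff.1 h'
    rw [e.symm_apply_apply]
    exact L.block_kept _ _ hu
  one_root := by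
    intro m
    have hk : ∀ w, AGraph.congr e L.kept w = none ↔ L.kept (e.symm w) = none := fun w =>
      Option.map_eq_none_iff
    refine ⟨e (L.root m), ⟨by simp, by simp [hk]⟩, ?_⟩
    rintro w ⟨rfl, hw⟩
    rw [hk] at hw
    rw [L.root_block hw, e.apply_symm_apply]

/-- Transport of tree covers along a bijection, as a bijection. -/
def congrEquiv {W : Type} (e : V ≃ W) : TreeCover V M ≃ TreeCover W M where
  toFun := congr e
  invFun := congr e.symm
  left_inv L := by
    apply TreeCover.ext
    · funext v; simp [congr]
    · exact (AGraph.congr e).symm_apply_apply L.kept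
  right_inv L := by
    apply TreeCover.ext
    · funext v; simp [congr]
    · exact (AGraph.congr e).apply_symm_apply L.kept

theorem root_congr {W : Type} (e : V ≃ W) (L : TreeCover V M) (m : M) :
    (L.congr e).root m = e (L.root m) := by
  have h : (L.congr e).kept (e (L.root m)) = none := by
    have := AGraph.isIso_congr e L.kept (L.root m)
    rw [L.kept_root] at this
    exact this
  have := (L.congr e).root_block h
  rw [← this]
  congr 1
  simp [congr]

theorem skel_congr {W : Type} {e : V ≃ W} {g : AGraph V} {g' : AGraph W} (h : IsIso e g g')
    (L : TreeCover V M) : (L.congr e).skel g' = L.skel g := by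
  funext m
  rw [skel, root_congr, h, Option.map_map, skel]
  congr 1
  funext v
  simp [congr]

theorem le_congr {W : Type} {e : V ≃ W} {g : AGraph V} {g' : AGraph W} (h : IsIso e g g')
    (L : TreeCover V M) : (L.congr e).Le g' ↔ L.Le g := by
  have hk : ∀ v, (L.congr e).kept (e v) = (L.kept v).map e := AGraph.isIso_congr e L.kept
  refine (e.forall_congr fun v => ?_).symm
  rw [hk, h, Option.map_eq_none_iff, (Option.map_injective e.injective).eq_iff]

theorem toAF_sub_congr {W : Type} [Fintype V] [Fintype W] [DecidableEq M] (e : V ≃ W)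
    (L : TreeCover V M) (m : M) : ((L.congr e).sub m).toAF = (L.sub m).toAF := by
  have hb : ∀ v, L.block v = m ↔ (L.congr e).block (e v) = m := fun v => by simp [congr]
  refine (IsIso.toAF_eq (e := e.subtypeEquiv hb) fun v => ?_).symm
  apply Option.map_injective Subtype.val_injective
  have h1 := AGraph.isIso_congr e L.kept v.1
  rw [← L.map_val_sub m v] at h1
  rw [(L.congr e).map_val_sub]
  refine h1.trans ?_
  cases L.sub m v <;> simp

end TreeCover

/-! ### The substitution product as a sum over tree covers -/

section SubstitutionProduct

variable {𝕜 : Type*} [RCLike 𝕜]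

/-- The contribution to the substitution product of the partitions with blocks labelled by
`Fin m`. -/
def labelledSubst {V : Type} [Fintype V] [DecidableEq V] (b : AT → 𝕜) (a : AF → 𝕜) (m : ℕ)
    (g : AGraph V) : 𝕜 := by
  classical
  exact ∑ L : TreeCover V (Fin m), if L.Le g then
    a (L.skel g).toAF * ∏ v, extendTree b (L.sub v).toAF else 0

theorem IsIso.labelledSubst_eq {V W : Type} [Fintype V] [DecidableEq V] [Fintype W]
    [DecidableEq W] {e : V ≃ W} {g : AGraph V} {g' : AGraph W} (h : IsIso e g g')
    (b : AT → 𝕜) (a : AF → 𝕜) (m : ℕ) : labelledSubst b a m g = labelledSubst b a m g' := by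
  classical
  unfold labelledSubst
  rw [← (TreeCover.congrEquiv e).sum_comp]
  refine Finset.sum_congr rfl fun L _ => ?_
  change _ = if (L.congr e).Le g' then a ((L.congr e).skel g').toAF
    * ∏ v, extendTree b ((L.congr e).sub v).toAF else 0
  simp only [TreeCover.le_congr h, TreeCover.skel_congr h, TreeCover.toAF_sub_congr]

namespace GPartition

variable {V M : Type} [Fintype V] [DecidableEq V] {g : AGraph V}

/-- The block of a vertex, as an element of the set of blocks. -/
def blockOf (p : GPartition g) (v : V) : {W // W ∈ p.blocks.parts} :=
  ⟨p.blocks.part v, p.blocks.part_mem.2 (Finset.mem_univ v)⟩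

theorem blockOf_eq_iff (p : GPartition g) (v : V) (W : {W // W ∈ p.blocks.parts}) :
    p.blockOf v = W ↔ v ∈ W.1 := by
  constructor
  · rintro rfl
    exact p.blocks.mem_part (Finset.mem_univ v)
  · intro h
    exact Subtype.ext (p.blocks.part_eq_of_mem W.2 h)

/-- The tree cover given by a partition and a labelling of its blocks. -/
def toCover (p : GPartition g) (σ : {W // W ∈ p.blocks.parts} ≃ M) : TreeCover V M where
  block v := σ (p.blockOf v)
  kept := p.kept
  block_kept v w h := congrArg σ (Subtype.ext (p.kept_mem v w h))
  one_root m := by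
    have h := p.one_root (σ.symm m).1 (σ.symm m).2
    simpa only [← Equiv.eq_symm_apply, blockOf_eq_iff] using h

theorem toCover_le (p : GPartition g) (σ : {W // W ∈ p.blocks.parts} ≃ M) : (p.toCover σ).Le g :=
  p.kept_sub

theorem root_toCover (p : GPartition g) (σ : {W // W ∈ p.blocks.parts} ≃ M)
    (W : {W // W ∈ p.blocks.parts}) : (p.toCover σ).root (σ W) = p.root W := by
  refine (p.one_root W.1 W.2).unique ⟨?_, (p.toCover σ).kept_root _⟩
    (p.one_root W.1 W.2).choose_spec.1
  rw [← blockOf_eq_iff]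
  exact σ.injective ((p.toCover σ).block_root (σ W))

theorem toAF_skel_toCover [Fintype M] (p : GPartition g)
    (σ : {W // W ∈ p.blocks.parts} ≃ M) : ((p.toCover σ).skel g).toAF = p.skeleton.toAF := by
  refine (IsIso.toAF_eq (e := σ) fun W => ?_).symm
  rw [TreeCover.skel, root_toCover, skeleton, Option.map_map]
  rfl

theorem toAF_sub_toCover [DecidableEq M] (p : GPartition g)
    (σ : {W // W ∈ p.blocks.parts} ≃ M) (W : {W // W ∈ p.blocks.parts}) :
    ((p.toCover σ).sub (σ W)).toAF = (p.subgraph W).toAF := by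
  have hb : ∀ v, v ∈ W.1 ↔ (p.toCover σ).block v = σ W := fun v => by
    rw [← blockOf_eq_iff, ← σ.apply_eq_iff_eq]
    rfl
  refine (IsIso.toAF_eq (e := (Equiv.refl V).subtypeEquiv hb) fun v => ?_).symm
  apply Option.map_injective Subtype.val_injective
  rw [(p.toCover σ).map_val_sub, subgraph, Option.map_map, Option.map_pmap]
  change p.kept v.1 = Option.pmap (fun w _ => w) (p.kept v.1) _
  simp

/-- Labelled partitions of `g` are the tree covers with edges in `g`. -/
theorem exists_toCover_eq (L : TreeCover V M) (h : L.Le g) :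
    ∃ (p : GPartition g) (σ : {W // W ∈ p.blocks.parts} ≃ M), p.toCover σ = L := by
  classical
  let P : Finpartition (Finset.univ : Finset V) := Finpartition.ofSetoid (Setoid.ker L.block)
  have hP : ∀ v w, w ∈ P.part v ↔ L.block v = L.block w := fun v w =>
    Finpartition.mem_part_ofSetoid_iff_rel
  have hpart : ∀ v w, P.part v = P.part w ↔ L.block v = L.block w := fun v w => by
    rw [← P.mem_part_iff_part_eq_part (Finset.mem_univ v) (Finset.mem_univ w), hP, eq_comm]
  let p : GPartition g :=
    { blocks := P
      kept := L.kept
      kept_sub := h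
      kept_mem := fun v w hvw => (hpart _ _).2 (L.block_kept v w hvw)
      one_root := by
        intro W hW
        obtain ⟨v, hv⟩ := P.nonempty_of_mem_parts hW
        obtain rfl := P.part_eq_of_mem hW hv
        have := L.one_root (L.block v)
        simpa only [hP, eq_comm (a := L.block v)] using this }
  let σ : {W // W ∈ P.parts} ≃ M :=
    { toFun := fun W => L.block (P.nonempty_of_mem_parts W.2).choose
      invFun := fun m => p.blockOf (L.root m)
      left_inv := by
        intro W
        refine (p.blockOf_eq_iff _ _).2 ?_
        have hv := (P.nonempty_of_mem_parts W.2).choose_spec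
        rw [← P.part_eq_of_mem W.2 hv, hP, L.block_root]
      right_inv := by
        intro m
        have hv := (P.nonempty_of_mem_parts (p.blockOf (L.root m)).2).choose_spec
        have hv' := (hP _ _).1 hv
        rw [L.block_root] at hv'
        exact hv'.symm }
  refine ⟨p, σ, TreeCover.ext ?_ rfl⟩
  funext v
  have hv := (P.nonempty_of_mem_parts (p.blockOf v).2).choose_spec
  exact ((hP _ _).1 hv).symm

theorem toCover_injective : Function.Injective
    fun x : Σ p : GPartition g, ({W // W ∈ p.blocks.parts} ≃ M) => x.1.toCover x.2 := by
  rintro ⟨p, σ⟩ ⟨p', σ'⟩ h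
  have hb : ∀ v, σ (p.blockOf v) = σ' (p'.blockOf v) := fun v =>
    congrFun (congrArg TreeCover.block h) v
  have hk : p.kept = p'.kept := congrArg TreeCover.kept h
  have hmem : ∀ v w, w ∈ p.blocks.part v ↔ w ∈ p'.blocks.part v := by
    intro v w
    have h1 := p.blockOf_eq_iff w (p.blockOf v)
    have h2 := p'.blockOf_eq_iff w (p'.blockOf v)
    rw [← σ.apply_eq_iff_eq, hb, hb, σ'.apply_eq_iff_eq] at h1
    exact h1.symm.trans h2
  have hpart : ∀ v, p.blocks.part v = p'.blocks.part v := fun v => Finset.ext (hmem v)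
  have hsub : ∀ q q' : GPartition g, (∀ v, q.blocks.part v = q'.blocks.part v) →
      q.blocks.parts ⊆ q'.blocks.parts := by
    intro q q' hq W hW
    obtain ⟨v, hv⟩ := q.blocks.nonempty_of_mem_parts hW
    rw [← q.blocks.part_eq_of_mem hW hv, hq]
    exact q'.blocks.part_mem.2 (Finset.mem_univ v)
  have hblocks : p.blocks = p'.blocks :=
    Finpartition.ext (Finset.Subset.antisymm (hsub p p' hpart) (hsub p' p fun v => (hpart v).symm))
  obtain rfl : p = p' := GPartition.ext hblocks hk
  congr 1
  ext W : 1
  obtain ⟨v, hv⟩ := p.blocks.nonempty_of_mem_parts W.2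
  rw [← (p.blockOf_eq_iff v W).2 hv, hb]

theorem card_labellings (p : GPartition g) (m : ℕ) :
    Fintype.card ({W // W ∈ p.blocks.parts} ≃ Fin m)
      = if p.blocks.parts.card = m then m.factorial else 0 := by
  split_ifs with h
  · rw [Fintype.card_equiv (Fintype.equivFinOfCardEq (by simpa using h))]
    simp [h]
  · rw [Fintype.card_eq_zero_iff]
    refine ⟨fun σ => h ?_⟩
    simpa using Fintype.card_congr σ

end GPartition

/-- A partition with `m` blocks has `m!` labellings. -/
theorem labelledSubst_eq_sum {V : Type} [Fintype V] [DecidableEq V] (b : AT → 𝕜) (a : AF → 𝕜)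
    (m : ℕ) (g : AGraph V) :
    labelledSubst b a m g = ∑ p : GPartition g, if p.blocks.parts.card = m then
      (m.factorial : 𝕜) * (a p.skeleton.toAF * ∏ W, b (p.tree W)) else 0 := by
  classical
  have h1 : labelledSubst b a m g
      = ∑ x : Σ p : GPartition g, ({W // W ∈ p.blocks.parts} ≃ Fin m),
        a x.1.skeleton.toAF * ∏ W, b (x.1.tree W) := by
    symm
    refine Finset.sum_of_injOn (fun x => x.1.toCover x.2)
      GPartition.toCover_injective.injOn (fun _ _ => by simp) ?_ ?_
    · intro L _ hL
      rw [if_neg]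
      intro hle
      obtain ⟨p, σ, rfl⟩ := GPartition.exists_toCover_eq L hle
      exact hL ⟨⟨p, σ⟩, by simp, rfl⟩
    · rintro ⟨p, σ⟩ -
      rw [if_pos (p.toCover_le σ), p.toAF_skel_toCover, ← σ.prod_comp]
      congr 1
      refine Finset.prod_congr rfl fun W _ => ?_
      rw [p.toAF_sub_toCover]
      exact (extendTree_coe b (p.tree W)).symm
  rw [h1, Fintype.sum_sigma]
  refine Finset.sum_congr rfl fun p _ => ?_
  refine (Finset.sum_const (a p.skeleton.toAF * ∏ W, b (p.tree W))).trans ?_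
  rw [Finset.card_univ, p.card_labellings, nsmul_eq_mul]
  split_ifs <;> simp

/-- The substitution product is the exponential sum of the contributions of the labelled
partitions. -/
theorem subst_toAF {V : Type} [Fintype V] [DecidableEq V] (b : AT → 𝕜) (a : AF → 𝕜) {N : ℕ}
    (g : AGraph V) (hN : Fintype.card V ≤ N) :
    subst b a g.toAF
      = ∑ m ∈ Finset.range (N + 1), ((m.factorial : 𝕜)⁻¹) * labelledSubst b a m g := by
  obtain ⟨e, he⟩ := g.exists_iso_toAF
  simp only [he.labelledSubst_eq, labelledSubst_eq_sum, Finset.mul_sum]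
  rw [Finset.sum_comm, subst]
  refine Finset.sum_congr rfl fun p _ => ?_
  have hp : p.blocks.parts.card ∈ Finset.range (N + 1) := by
    have := p.blocks.card_parts_le_card
    rw [Finset.card_univ, Fintype.card_fin] at this
    have := g.size_toAF
    exact Finset.mem_range.2 (by omega)
  rw [Finset.sum_eq_single_of_mem _ hp]
  · rw [if_pos rfl, inv_mul_cancel_left₀ (Nat.cast_ne_zero.2 (Nat.factorial_ne_zero _))]
  · intro m _ hm
    rw [if_neg hm.symm, mul_zero]

end SubstitutionProduct

/-! ### Substituting a B-series into an elementary differential operator -/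

section Substitution

variable {𝕂 𝕜 : Type*} [RCLike 𝕂] [RCLike 𝕜] [NormedAlgebra 𝕂 𝕜] {d : ℕ}

/-- The terms of an aromatic B-series, in component `k`, from the graphs with vertex set `W`. -/
def treeSum (f : Fin d → Formal 𝕂 𝕜 d) (b : AT → 𝕜) (k : Fin d) (W : Type) [Fintype W]
    [DecidableEq W] : Formal 𝕂 𝕜 d :=
  ∑ t : AGraph W, extendTree b t.toAF • elemDiff f t (PowerSeries.C (coord k))

theorem treeSum_congr (f : Fin d → Formal 𝕂 𝕜 d) (b : AT → 𝕜) (k : Fin d) {V W : Type}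
    [Fintype V] [DecidableEq V] [Fintype W] [DecidableEq W] (e : V ≃ W) :
    treeSum f b k V = treeSum f b k W := by
  unfold treeSum
  rw [← (AGraph.congr e).sum_comp]
  refine Finset.sum_congr rfl fun t _ => ?_
  rw [(AGraph.isIso_congr e t).toAF_eq, (AGraph.isIso_congr e t).elemDiff_eq f]

theorem X_pow_dvd_treeSum {f : Fin d → Formal 𝕂 𝕜 d}
    (hf : ∀ i, PowerSeries.constantCoeff (f i) = 0) (b : AT → 𝕜) (k : Fin d) (W : Type)
    [Fintype W] [DecidableEq W] : PowerSeries.X ^ Fintype.card W ∣ treeSum f b k W := by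
  refine Finset.dvd_sum fun t _ => ?_
  rw [Algebra.smul_def]
  exact (X_pow_dvd_elemDiff hf t _).mul_left _

/-- The terms, from the graphs on the vertex set `V`, of the operator of `s` with a B-series in
place of the vector field. -/
theorem sum_prod_treeSum {V : Type} [Fintype V] [DecidableEq V] {m : ℕ} (s : AGraph (Fin m))
    (f : Fin d → Formal 𝕂 𝕜 d) (b : AT → 𝕜) (G : Formal 𝕂 𝕜 d) :
    ∑ j : Fin m → Fin d, (∑ c : V → Fin m, ∏ v, iterPd j (s.pred v)
        (treeSum f b (j v) {p // c p = v})) * iterPd j s.roots G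
      = ∑ L : TreeCover V (Fin m), (∏ v, extendTree b (L.sub v).toAF) •
          ∑ ext : Fin m → Option V, if (∀ e, (ext e).map L.block = s e) then
            elemDiff f (L.graft ext) G else 0 := by
  simp only [← sum_elemDiff_sub]
  rw [← TreeCover.sum_block_sub (fun c t => (∏ v, extendTree b (t v).toAF) •
    ∑ j : Fin m → Fin d, (∏ v, iterPd j (s.pred v)
      (elemDiff f (t v) (PowerSeries.C (coord (j v))))) * iterPd j s.roots G)]
  · simp only [Finset.sum_mul, Finset.smul_sum]
    rw [Finset.sum_comm]
    refine Finset.sum_congr rfl fun c _ => ?_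
    rw [Finset.sum_comm]
    refine Finset.sum_congr rfl fun j _ => ?_
    simp only [treeSum, ← iterPdLin_apply, map_sum, map_smul]
    rw [Finset.prod_univ_sum, Fintype.piFinset_univ, Finset.sum_mul]
    refine Finset.sum_congr rfl fun t _ => ?_
    rw [Finset.prod_smul, smul_mul_assoc]
  · intro c t v h
    rw [Finset.prod_eq_zero (Finset.mem_univ v) (extendTree_eq_zero b h), zero_smul]

/-- Summation over all skeletons yields the labelled contributions to the substitution product. -/
theorem sum_smul_sum_prod_treeSum {V : Type} [Fintype V] [DecidableEq V] (m : ℕ)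
    (f : Fin d → Formal 𝕂 𝕜 d) (b : AT → 𝕜) (a : AF → 𝕜) (G : Formal 𝕂 𝕜 d) :
    ∑ s : AGraph (Fin m), a s.toAF • ∑ j : Fin m → Fin d,
        (∑ c : V → Fin m, ∏ v, iterPd j (s.pred v) (treeSum f b (j v) {p // c p = v}))
          * iterPd j s.roots G
      = ∑ g : AGraph V, labelledSubst b a m g • elemDiff f g G := by
  classical
  simp only [sum_prod_treeSum, labelledSubst, Finset.sum_smul, Finset.smul_sum]
  rw [Finset.sum_comm, Finset.sum_comm (s := (Finset.univ : Finset (AGraph V)))]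
  refine Finset.sum_congr rfl fun L _ => ?_
  simp only [ite_smul, zero_smul]
  rw [← L.sum_graft fun g =>
    (a (L.skel g).toAF * ∏ v, extendTree b (L.sub v).toAF) • elemDiff f g G, Finset.sum_comm]
  refine Finset.sum_congr rfl fun ext _ => ?_
  have hs : ∀ s : AGraph (Fin m), (∀ e, (ext e).map L.block = s e) ↔ L.skel (L.graft ext) = s :=
    fun s => by
      rw [funext_iff]
      simp only [L.skel_graft]
  simp only [hs, smul_ite, smul_zero]
  rw [Finset.sum_ite_eq, if_pos (Finset.mem_univ _), smul_smul]

/-- The operator of `s`, with a truncated B-series in place of the vector field, expanded by the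
number of nodes. -/
theorem X_pow_dvd_elemDiff_sTrunc_sub {m : ℕ} (s : AGraph (Fin m)) {f : Fin d → Formal 𝕂 𝕜 d}
    (hf : ∀ i, PowerSeries.constantCoeff (f i) = 0) (b : AT → 𝕜) (G : Formal 𝕂 𝕜 d) (N : ℕ) :
    PowerSeries.X ^ (N + 1) ∣
      elemDiff (fun j => sTrunc N f (extendTree b) (PowerSeries.C (coord j))) s G
      - ∑ n ∈ Finset.range (N + 1), ((n.factorial : 𝕜)⁻¹) • ∑ j : Fin m → Fin d,
          (∑ c : Fin n → Fin m, ∏ v, iterPd j (s.pred v)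
            (treeSum f b (j v) {p // c p = v})) * iterPd j s.roots G := by
  -- the sum over the graphs on a fibre depends only on the size of the fibre
  have h1 : ∑ n ∈ Finset.range (N + 1), ((n.factorial : 𝕜)⁻¹) • ∑ j : Fin m → Fin d,
      (∑ c : Fin n → Fin m, ∏ v, iterPd j (s.pred v)
        (treeSum f b (j v) {p // c p = v})) * iterPd j s.roots G
      = ∑ j : Fin m → Fin d, (∑ n ∈ Finset.range (N + 1), ((n.factorial : 𝕜)⁻¹) •
          ∑ c : Fin n → Fin m, ∏ v, iterPd j (s.pred v)
            (treeSum f b (j v) (Fin (Finset.univ.filter fun p => c p = v).card)))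
              * iterPd j s.roots G := by
    simp only [Finset.smul_sum, Finset.sum_mul]
    rw [Finset.sum_comm]
    refine Finset.sum_congr rfl fun j _ => Finset.sum_congr rfl fun n _ =>
      Finset.sum_congr rfl fun c _ => ?_
    rw [smul_mul_assoc]
    congr 2
    refine Finset.prod_congr rfl fun v _ => ?_
    rw [treeSum_congr f b (j v) (Fintype.equivFinOfCardEq (Fintype.card_subtype fun p => c p = v))]
  rw [h1, elemDiff, ← Finset.sum_sub_distrib]
  refine Finset.dvd_sum fun j _ => ?_
  rw [← sub_mul]
  refine Dvd.dvd.mul_right ?_ _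
  have h2 : ∀ v, iterPd j (s.pred v) (sTrunc N f (extendTree b) (PowerSeries.C (coord (j v))))
      = ∑ k ∈ Finset.range (N + 1), ((k.factorial : 𝕜)⁻¹) •
        iterPd j (s.pred v) (treeSum f b (j v) (Fin k)) := by
    intro v
    simp only [sTrunc, ← iterPdLin_apply, map_sum (iterPdLin j (s.pred v)), map_smul, treeSum]
  simp only [h2]
  refine X_pow_dvd_prod_sum_sub (𝕜 := 𝕜) PowerSeries.X
    (fun v k => iterPd j (s.pred v) (treeSum f b (j v) (Fin k))) (fun v k => ?_) N
  have := X_pow_dvd_treeSum hf b (j v) (Fin k)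
  rw [Fintype.card_fin] at this
  exact X_pow_dvd_iterPd _ _ this

/-- The substitution law, for a vector field without constant term in `h`. -/
theorem sSeries_bSeries {f : Fin d → Formal 𝕂 𝕜 d}
    (hf : ∀ i, PowerSeries.constantCoeff (f i) = 0) (b : AT → 𝕜) (a : AF → 𝕜)
    (G : Formal 𝕂 𝕜 d) : sSeries (bSeries f b) a G = sSeries f (subst b a) G := by
  ext1 N
  rw [coeff_sSeries (constantCoeff_bSeries hf b) a G le_rfl, coeff_sSeries hf _ G le_rfl,
    ← sub_eq_zero, ← map_sub]
  refine coeff_eq_zero_of_X_pow_dvd (k := N + 1) ?_ (Nat.lt_succ_self N)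
  -- the right-hand side, with the sums over `n` (all nodes) and `m` (nodes of the skeleton)
  -- exchanged
  have hR : sTrunc N f (subst b a) G = ∑ m ∈ Finset.range (N + 1), ((m.factorial : 𝕜)⁻¹) •
      ∑ s : AGraph (Fin m), a s.toAF • ∑ n ∈ Finset.range (N + 1), ((n.factorial : 𝕜)⁻¹) •
        ∑ j : Fin m → Fin d, (∑ c : Fin n → Fin m, ∏ v, iterPd j (s.pred v)
          (treeSum f b (j v) {p // c p = v})) * iterPd j s.roots G := by
    have h1 : ∀ m, ∑ s : AGraph (Fin m), a s.toAF • ∑ n ∈ Finset.range (N + 1),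
        ((n.factorial : 𝕜)⁻¹) • ∑ j : Fin m → Fin d, (∑ c : Fin n → Fin m, ∏ v,
          iterPd j (s.pred v) (treeSum f b (j v) {p // c p = v})) * iterPd j s.roots G
        = ∑ n ∈ Finset.range (N + 1), ((n.factorial : 𝕜)⁻¹) •
          ∑ g : AGraph (Fin n), labelledSubst b a m g • elemDiff f g G := by
      intro m
      simp only [← sum_smul_sum_prod_treeSum]
      rw [Finset.sum_congr rfl fun s _ => Finset.smul_sum, Finset.sum_comm]
      refine Finset.sum_congr rfl fun n _ => ?_
      rw [Finset.smul_sum]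
      refine Finset.sum_congr rfl fun s _ => ?_
      rw [smul_comm]
    simp only [h1]
    rw [Finset.sum_congr rfl fun m _ => Finset.smul_sum, Finset.sum_comm, sTrunc]
    refine Finset.sum_congr rfl fun n hn => ?_
    rw [Finset.sum_congr rfl fun m _ => smul_comm _ _ _, ← Finset.smul_sum,
      Finset.sum_congr rfl fun m _ => Finset.smul_sum, Finset.sum_comm]
    congr 1
    refine Finset.sum_congr rfl fun g _ => ?_
    rw [subst_toAF b a (N := N) g (by
      rw [Fintype.card_fin]
      exact Nat.le_of_lt_succ (Finset.mem_range.1 hn)), Finset.sum_smul]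
    simp only [smul_smul]
  rw [hR, sTrunc, ← Finset.sum_sub_distrib]
  refine Finset.dvd_sum fun m _ => ?_
  rw [← smul_sub, ← Finset.sum_sub_distrib, Algebra.smul_def]
  refine Dvd.dvd.mul_left (Finset.dvd_sum fun s _ => ?_) _
  rw [← smul_sub, Algebra.smul_def]
  refine Dvd.dvd.mul_left ?_ _
  have hB : ∀ j, PowerSeries.X ^ (N + 1) ∣ bSeries f b j
      - sTrunc N f (extendTree b) (PowerSeries.C (coord j)) := by
    intro j
    rw [PowerSeries.X_pow_dvd_iff]
    intro n hn
    rw [map_sub, sub_eq_zero, bSeries_eq_sSeries, coeff_sSeries hf _ _ (Nat.le_of_lt_succ hn)]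
  have h3 := dvd_add (X_pow_dvd_elemDiff_sub hB s G) (X_pow_dvd_elemDiff_sTrunc_sub s hf b G N)
  rwa [sub_add_sub_cancel] at h3

end Substitution

/-! ### The step size as a factor of the vector field -/

section StepSize

variable {𝕂 𝕜 : Type*} [RCLike 𝕂] [RCLike 𝕜] [NormedAlgebra 𝕂 𝕜] {d : ℕ}

theorem X_pow_mul_sTerm (f : Fin d → Formal 𝕂 𝕜 d) (a : AF → 𝕜) (G : Formal 𝕂 𝕜 d) (φ : AF) :
    PowerSeries.X ^ φ.size * sTerm f a G φ = sTerm (fun j => PowerSeries.X * f j) a G φ := by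
  rw [sTerm, sTerm, elemDiff_X_mul, Fintype.card_fin, mul_smul_comm]

theorem X_pow_mul_bTerm (f : Fin d → Formal 𝕂 𝕜 d) (b : AT → 𝕜) (j : Fin d) (τ : AT) :
    PowerSeries.X ^ τ.1.size * bTerm f b j τ = bTerm (fun j => PowerSeries.X * f j) b j τ := by
  rw [bTerm, bTerm, elemDiff_X_mul, Fintype.card_fin, mul_smul_comm]

theorem sSeriesStep_eq (f : Fin d → Formal 𝕂 𝕜 d) (a : AF → 𝕜) (G : Formal 𝕂 𝕜 d) :
    sSeriesStep f a G = sSeries (fun j => PowerSeries.X * f j) a G := by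
  simp only [sSeriesStep, X_pow_mul_sTerm]
  rfl

theorem bSeriesStep_eq (f : Fin d → Formal 𝕂 𝕜 d) (b : AT → 𝕜) :
    bSeriesStep f b = bSeries (fun j => PowerSeries.X * f j) b := by
  funext j
  simp only [bSeriesStep, X_pow_mul_bTerm]
  rfl

end StepSize

end

end Aromatic

theorem theorem5p3 {𝕂 𝕜 : Type*} [RCLike 𝕂] [RCLike 𝕜] [NormedAlgebra 𝕂 𝕜] {d : ℕ}
    (f : Fin d → Aromatic.Formal 𝕂 𝕜 d) (b : Aromatic.AT → 𝕜) (a : Aromatic.AF → 𝕜) :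
    -- the step size is contained in `f`
    ((∀ i, PowerSeries.constantCoeff (f i) = 0) →
      (∀ j, Aromatic.FormallySummable (Aromatic.bTerm f b j)) ∧
      ∀ G : Aromatic.Formal 𝕂 𝕜 d,
        Aromatic.FormallySummable (Aromatic.sTerm (Aromatic.bSeries f b) a G) ∧
        Aromatic.FormallySummable (Aromatic.sTerm f (Aromatic.subst b a) G) ∧
        Aromatic.sSeries (Aromatic.bSeries f b) a G =
          Aromatic.sSeries f (Aromatic.subst b a) G) ∧
    -- the step size is written out
    ((∀ j, Aromatic.FormallySummable fun τ : Aromatic.AT =>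
        PowerSeries.X ^ τ.1.size * Aromatic.bTerm f b j τ) ∧
      ∀ G : Aromatic.Formal 𝕂 𝕜 d,
        Aromatic.FormallySummable (Aromatic.sTerm (Aromatic.bSeriesStep f b) a G) ∧
        (Aromatic.FormallySummable fun φ : Aromatic.AF =>
          PowerSeries.X ^ φ.size * Aromatic.sTerm f (Aromatic.subst b a) G φ) ∧
        Aromatic.sSeries (Aromatic.bSeriesStep f b) a G =
          Aromatic.sSeriesStep f (Aromatic.subst b a) G) := by
  have key : ∀ F : Fin d → Aromatic.Formal 𝕂 𝕜 d, (∀ i, PowerSeries.constantCoeff (F i) = 0) →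
      (∀ j, Aromatic.FormallySummable (Aromatic.bTerm F b j)) ∧
      ∀ G : Aromatic.Formal 𝕂 𝕜 d,
        Aromatic.FormallySummable (Aromatic.sTerm (Aromatic.bSeries F b) a G) ∧
        Aromatic.FormallySummable (Aromatic.sTerm F (Aromatic.subst b a) G) ∧
        Aromatic.sSeries (Aromatic.bSeries F b) a G =
          Aromatic.sSeries F (Aromatic.subst b a) G := fun F hF =>
    ⟨Aromatic.formallySummable_bTerm hF b, fun G =>
      ⟨Aromatic.formallySummable_sTerm (Aromatic.constantCoeff_bSeries hF b) a G,
        Aromatic.formallySummable_sTerm hF _ G, Aromatic.sSeries_bSeries hF b a G⟩⟩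
  refine ⟨key f, ?_⟩
  simp only [Aromatic.X_pow_mul_bTerm, Aromatic.X_pow_mul_sTerm, Aromatic.sSeriesStep_eq,
    Aromatic.bSeriesStep_eq]
  exact key (fun j => PowerSeries.X * f j) fun i => by simp
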